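/- A function $f:\mathbb R\to\mathbb C$ is almost periodic, $f\in AP(\mathbb R)$, if it is continuous and its $\varepsilon$-almost periods are relatively dense for every $\varepsilon>0$ (Bohr); equivalently, if it is a uniform limit on $\mathbb R$ of trigonometric polynomials. For $f\in AP(\mathbb R)$ put $M(f)=\lim_{L\to\infty}\frac1{2L}\int_{-L}^{L}f(x)\,dx$ and $\widehat f(\alpha)=M(f e^{-i\alpha x})$, $\alpha\in\mathbb R$. Fix $\omega=\{\omega_j\}_{j\ge1}\in\mathbb R^{\mathbb N}$ and let $\Gamma_\omega\subset\mathbb R$ be the set of all $\omega\cdot n=\sum_j n_j\omega_j$ with $n$ a finitely supported integer sequence. Let $\mathcal A_\omega(\mathbb R)$ be the space of those $f\in AP(\mathbb R)$ with $\widehat f(\alpha)=0$ for $\alpha\notin\Gamma_\omega$ and $\|f\|_{\mathcal A_\omega}:=\sum_{\alpha\in\Gamma_\omega}|\widehat f(\alpha)|<\infty$, and let $S(t)f=\sum_{\alpha\in\Gamma_\omega}\widehat f(\alpha)e^{-i\alpha^2t}e^{i\alpha x}$. **Theorem 1.2.** Let $p\ge 2$ be an even integer, $\lambda\in\mathbb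 C$, $f\in\mathcal A_\omega(\mathbb R)$. Let $u\in C(I;\mathcal A_\omega(\mathbb R))$ be the solution of $i\partial_tu+\partial_x^2u=\lambda|u|^p$, $u|_{t=0}=f$, that is, $$u(t)=S(t)f-i\lambda\int_0^tS(t-t')|u(t')|^p\,dt',\qquad t\in I,$$ where $I=(-T_-,T_+)\ni0$, $0<T_\pm\le\infty$, is the maximal time interval of existence (that is, $u$ does not extend to a solution on a larger open interval). If $$\operatorname{Re}\lambda\cdot\operatorname{Im}M(f)\ne0\quad\text{or}\quad\operatorname{Im}\lambda\cdot\operatorname{Re}M(f)\ne0,$$ then $\min(T_-,T_+)<\infty$. More precisely: (i) If $\operatorname{Re}\lambda\cdot\operatorname{Im}M(f)<0$ or $\operatorname{Im}\lambda\cdot\operatorname{Re}M(f)>0$, then $T_+<\infty$ and $\liminf_{t\nearrow T_+}\|u(t)\|_{\mathcal A_\omega}=\infty$. (ii) If $\operatorname{Re}\lambda\cdot\operatorname{Im}M(f)>0$ or $\operatorname{Im}\lambda\cdot\operatorname{Re}M(f)<0$, then $T_-<\infty$ and $\liminf_{t\searrow-T_-}\|u(t)\|_{\mathcal A_\omega}=\infty$.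 -/

import Mathlib

open Filter Topology
open scoped ENNReal

noncomputable section

namespace APNLS

/-- The trigonometric polynomial `∑ₐ c(a) e^{i a x}` with finitely many real frequencies `a`. -/
def trigPoly (c : ℝ →₀ ℂ) (x : ℝ) : ℂ :=
  c.sum fun a z => z * Complex.exp (Complex.I * a * x)

/-- Almost periodic functions on `ℝ`: functions that can be approximated, uniformly on `ℝ` and to
any accuracy, by trigonometric polynomials. (By Bohr's theorem this is the class of continuous
functions whose `ε`-almost periods are relatively dense for every `ε > 0`.) -/
def IsAlmostPeriodic (f : ℝ → ℂ) : Prop :=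
  ∀ ε : ℝ, 0 < ε → ∃ c : ℝ →₀ ℂ, ∀ x : ℝ, ‖f x - trigPoly c x‖ < ε

/-- The mean value `M(f) = lim_{L → ∞} (1 / 2L) ∫_{-L}^{L} f(x) dx`; the limit exists for every
almost periodic `f`. -/
def meanValue (f : ℝ → ℂ) : ℂ :=
  limUnder atTop fun L : ℝ => ((1 / (2 * L) : ℝ) : ℂ) * ∫ x in (-L)..L, f x

/-- The Fourier coefficient `f̂(a) = M(f e^{-i a x})`. -/
def fourierCoeffAP (f : ℝ → ℂ) (a : ℝ) : ℂ :=
  meanValue fun x => f x * Complex.exp (-(Complex.I * a * x))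

/-- `ω · n = ∑ⱼ nⱼ ωⱼ`, for a finitely supported integer sequence `n`. -/
def freqDot (ω : ℕ → ℝ) (n : ℕ →₀ ℤ) : ℝ :=
  n.sum fun j k => (k : ℝ) * ω j

/-- The set `ω · ℤ^ℕ` of all admissible frequencies. -/
def freqSet (ω : ℕ → ℝ) : Set ℝ := Set.range (freqDot ω)

/-- The `A_ω`-norm: the `ℓ¹`-norm of the Fourier coefficients over the frequencies in `ω · ℤ^ℕ`,
with values in `[0, ∞]`. For linearly independent `ω` the map `n ↦ ω · n` is injective, and this is
the sum of `|f̂(ω · n)|` over `n`. -/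
def normA (ω : ℕ → ℝ) (f : ℝ → ℂ) : ℝ≥0∞ :=
  ∑' a : freqSet ω, ‖fourierCoeffAP f a‖ₑ

/-- The space `A_ω(ℝ)`: almost periodic functions whose frequency set is contained in `ω · ℤ^ℕ` and
whose `A_ω`-norm is finite. -/
structure MemA (ω : ℕ → ℝ) (f : ℝ → ℂ) : Prop where
  almostPeriodic : IsAlmostPeriodic f
  freq_mem : ∀ a : ℝ, fourierCoeffAP f a ≠ 0 → a ∈ freqSet ω
  norm_lt_top : normA ω f < ⊤

/-- The linear Schrödinger propagator `S(t) = e^{i t ∂ₓ²}` on `A_ω(ℝ)`: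
`S(t) f = ∑ₐ f̂(a) e^{-i a² t} e^{i a x}`, the sum being over `a ∈ ω · ℤ^ℕ`. -/
def propagator (ω : ℕ → ℝ) (t : ℝ) (f : ℝ → ℂ) (x : ℝ) : ℂ :=
  ∑' a : freqSet ω, fourierCoeffAP f a *
    Complex.exp (-(Complex.I * ((a : ℝ) : ℂ) ^ 2 * t)) * Complex.exp (Complex.I * (a : ℝ) * x)

/-- The open time interval `(-Tm, Tp)`, where `Tm` and `Tp` may be infinite. -/
def timeInterval (Tm Tp : EReal) : Set ℝ := {t : ℝ | -Tm < (t : EReal) ∧ (t : EReal) < Tp}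

/-- `u ∈ C((-Tm, Tp); A_ω(ℝ))` is a solution of `i ∂ₜ u + ∂ₓ² u = lam |u|^p` with `u(0) = f`:
it satisfies `u(t) = S(t) f - i lam ∫₀ᵗ S(t - s) |u(s)|^p ds`. The integrand is continuous with
values in `A_ω(ℝ)`, where evaluation at a point is continuous, so that the identity may be
written at every point `x`. -/
structure IsSolution (ω : ℕ → ℝ) (p : ℕ) (lam : ℂ) (f : ℝ → ℂ) (Tm Tp : EReal)
    (u : ℝ → ℝ → ℂ) : Prop where
  mem : ∀ t ∈ timeInterval Tm Tp, MemA ω (u t)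
  cont : ∀ t ∈ timeInterval Tm Tp,
    Tendsto (fun s => normA ω (fun x => u s x - u t x)) (𝓝[timeInterval Tm Tp] t) (𝓝 0)
  initial : u 0 = f
  duhamel : ∀ t ∈ timeInterval Tm Tp, ∀ x : ℝ,
    u t x = propagator ω t f x -
      Complex.I * lam * ∫ s in (0 : ℝ)..t, propagator ω (t - s) (fun y => ((‖u s y‖ ^ p : ℝ) : ℂ)) x

/-- `u` is a solution on `(-Tm, Tp) ∋ 0`, and this interval is the maximal interval of existence:
`u` does not extend to a solution on a larger open interval. -/
structure IsMaximalSolution (ω : ℕ → ℝ) (p : ℕ) (lam : ℂ) (f : ℝ → ℂ) (Tm Tp : EReal)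
    (u : ℝ → ℝ → ℂ) : Prop where
  pos_left : 0 < Tm
  pos_right : 0 < Tp
  sol : IsSolution ω p lam f Tm Tp u
  maximal : ∀ (Sm Sp : EReal) (v : ℝ → ℝ → ℂ), Tm ≤ Sm → Tp ≤ Sp →
    IsSolution ω p lam f Sm Sp v → (∀ t ∈ timeInterval Tm Tp, v t = u t) → Sm = Tm ∧ Sp = Tp

end APNLS

end

/-! An almost periodic function is determined by its Fourier coefficients, so `A_ω` is isometric to
`ℓ¹(Γ)` with `Γ` the group of frequencies (`MemA.exists_eval`, `normA_eval`). Since `p = 2k`, `|u|^p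
= (u ū)^k` is a polynomial expression in the convolution algebra. Writing `u(t) = S(t) w(t)` turns
the Duhamel formula into an ODE `w' = field t w` in a Banach space, whose right-hand side is bounded
and Lipschitz on balls, uniformly in time.

The propagator acts trivially on frequency `0`, so the mean `c(t) = M(u(t))` satisfies `c' = -iλ
M(|u|^p)`. Jensen's inequality (`norm_pow_le_absPow_zero`) gives `M(|u|^p) ≥ |c|^p`, and this mean
is real. Hence `Re c` and `Im c` have derivatives `Im λ · q` and `-Re λ · q` with `q ≥ |c|^p`. If
one of them starts with the sign of its factor, it obeys a superlinear inequality `y' ≥ κ y^p` and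
cannot live for all positive times (`not_global_of_deriv_ge_pow`). Opposite signs are treated by
reversing time.

At a finite endpoint the local existence time depends only on a bound for the norm. If the liminf of
the norm were finite, the solution could be restarted arbitrarily close to the endpoint from data in
one fixed ball, and would continue past it (`IsTameField.exists_extension_right`), against
maximality. -/

noncomputable section

namespace APNLS

/-! ### The space `ℓ¹(ι)` of absolutely summable families -/

/-- Absolutely summable families of complex numbers. -/
def L1 (ι : Type*) : Type _ := lp (fun _ : ι => ℂ) 1

namespace L1

section Basic

variable {ι : Type*}

instance : NormedAddCommGroup (L1 ι) :=
  inferInstanceAs (NormedAddCommGroup (lp (fun _ : ι => ℂ) 1))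

instance : NormedSpace ℂ (L1 ι) :=
  inferInstanceAs (NormedSpace ℂ (lp (fun _ : ι => ℂ) 1))

instance : CompleteSpace (L1 ι) :=
  inferInstanceAs (CompleteSpace (lp (fun _ : ι => ℂ) 1))

/-- The coordinates as continuous linear functionals. -/
def coord (i : ι) : L1 ι →L[ℂ] ℂ := lp.evalCLM ℂ (fun _ : ι => ℂ) 1 i

instance : FunLike (L1 ι) ι ℂ where
  coe w i := coord i w
  coe_injective _ _ h := lp.ext (E := fun _ : ι => ℂ) (p := 1) h

theorem ext {v w : L1 ι} (h : ∀ i, v i = w i) : v = w := DFunLike.ext v w h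

@[simp]
theorem coord_apply (i : ι) (w : L1 ι) : coord i w = w i := rfl

@[simp]
theorem add_apply (v w : L1 ι) (i : ι) : (v + w) i = v i + w i := rfl

@[simp]
theorem sub_apply (v w : L1 ι) (i : ι) : (v - w) i = v i - w i := rfl

@[simp]
theorem smul_apply (c : ℂ) (w : L1 ι) (i : ι) : (c • w) i = c * w i := rfl

theorem hasSum_norm (w : L1 ι) : HasSum (fun i => ‖w i‖) ‖w‖ := by
  have h := lp.hasSum_norm (E := fun _ : ι => ℂ) (p := 1) (by simp) w
  simp only [ENNReal.toReal_one, Real.rpow_one] at h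
  exact h

theorem norm_apply_le (w : L1 ι) (i : ι) : ‖w i‖ ≤ ‖w‖ :=
  lp.norm_apply_le_norm (E := fun _ : ι => ℂ) (p := 1) one_ne_zero w i

/-- An absolutely summable family as an element of `ℓ¹(ι)`. -/
def ofSummable (c : ι → ℂ) (hc : Summable fun i => ‖c i‖) : L1 ι :=
  (⟨c, memℓp_gen (by simpa using hc)⟩ : lp (fun _ : ι => ℂ) 1)

@[simp]
theorem ofSummable_apply (c : ι → ℂ) (hc : Summable fun i => ‖c i‖) (i : ι) :
    ofSummable c hc i = c i := rfl

open Classical in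
/-- The unit vectors of `ℓ¹(ι)`. -/
def delta (i : ι) : L1 ι := lp.single (E := fun _ : ι => ℂ) 1 i 1

theorem delta_apply_self (i : ι) : (delta i : L1 ι) i = 1 := by
  classical
  exact lp.single_apply_self (E := fun _ : ι => ℂ) 1 i 1

theorem delta_apply_ne {i j : ι} (h : j ≠ i) : (delta i : L1 ι) j = 0 := by
  classical
  exact lp.single_apply_ne (E := fun _ : ι => ℂ) 1 i 1 h

theorem norm_delta (i : ι) : ‖(delta i : L1 ι)‖ = 1 := by
  refine (hasSum_norm _).unique ?_
  have h := hasSum_single (f := fun j => ‖(delta i : L1 ι) j‖) i fun j hj => by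
    rw [delta_apply_ne hj, norm_zero]
  rwa [delta_apply_self, norm_one] at h

theorem hasSum_delta (w : L1 ι) : HasSum (fun i => w i • delta i) w := by
  classical
  have h := lp.hasSum_single (E := fun _ : ι => ℂ) (p := 1) (by simp) w
  have e (i : ι) : (w i • delta i : L1 ι) = lp.single (E := fun _ : ι => ℂ) 1 i (w i) := by
    refine ext fun j => ?_
    rw [smul_apply]
    by_cases hj : j = i
    · subst hj
      rw [delta_apply_self, mul_one]
      exact (lp.single_apply_self (E := fun _ : ι => ℂ) 1 j (w j)).symm
    · rw [delta_apply_ne hj, mul_zero]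
      exact (lp.single_apply_ne (E := fun _ : ι => ℂ) 1 i (w i) hj).symm
  simp only [e]
  exact h

end Basic

variable {ι : Type*} {E : Type*} [NormedAddCommGroup E] [NormedSpace ℂ E]

/-- The unit vectors span a dense subspace. Algebraic identities for convolution, evaluation and
propagator thereby reduce to identities for single characters. -/
theorem clm_ext {S T : L1 ι →L[ℂ] E} (h : ∀ i, S (delta i) = T (delta i)) : S = T := by
  ext w
  have h1 := (hasSum_delta w).mapL S
  have h2 := (hasSum_delta w).mapL T
  refine h1.unique ?_
  convert h2 using 2 with i
  simp [h]

variable [CompleteSpace E]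

theorem summable_smul {v : ι → E} (hv : ∀ i, ‖v i‖ ≤ 1) (w : L1 ι) :
    Summable fun i => w i • v i :=
  .of_norm_bounded (hasSum_norm w).summable fun i => by
    rw [norm_smul]
    exact mul_le_of_le_one_right (norm_nonneg _) (hv i)

/-- The continuous linear map on `ℓ¹(ι)` sending the unit vectors to a given family in the unit
ball. -/
def lift (v : ι → E) (hv : ∀ i, ‖v i‖ ≤ 1) : L1 ι →L[ℂ] E :=
  LinearMap.mkContinuous
    { toFun := fun w => ∑' i, w i • v i
      map_add' := fun w z => by
        rw [← (summable_smul hv w).tsum_add (summable_smul hv z)]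
        simp [add_smul]
      map_smul' := fun c w => by
        rw [← (summable_smul hv w).tsum_const_smul]
        simp [mul_smul] }
    1 fun w => by
      refine tsum_of_norm_bounded (by simpa using hasSum_norm w) fun i => ?_
      rw [norm_smul]
      exact mul_le_of_le_one_right (norm_nonneg _) (hv i)

theorem lift_apply (v : ι → E) (hv : ∀ i, ‖v i‖ ≤ 1) (w : L1 ι) :
    lift v hv w = ∑' i, w i • v i := rfl

@[simp]
theorem lift_delta (v : ι → E) (hv : ∀ i, ‖v i‖ ≤ 1) (i : ι) : lift v hv (delta i) = v i := by
  rw [lift_apply, tsum_eq_single i fun j hj => by simp [delta_apply_ne hj], delta_apply_self,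
    one_smul]

theorem norm_lift_le (v : ι → E) (hv : ∀ i, ‖v i‖ ≤ 1) : ‖lift v hv‖ ≤ 1 :=
  LinearMap.mkContinuous_norm_le _ zero_le_one _

theorem norm_lift_apply_le (v : ι → E) (hv : ∀ i, ‖v i‖ ≤ 1) (w : L1 ι) : ‖lift v hv w‖ ≤ ‖w‖ := by
  simpa using (lift v hv).le_of_opNorm_le (norm_lift_le v hv) w

end L1

/-! ### The convolution algebra of a subgroup of `ℝ` -/

section Algebra

variable {Γ : AddSubgroup ℝ}

open L1

/-- Translation of the index by `a`. -/
def shift (a : Γ) : L1 Γ →L[ℂ] L1 Γ :=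
  lift (fun b => delta (a + b)) fun _ => (norm_delta _).le

theorem norm_shift_le (a : Γ) : ‖shift a‖ ≤ 1 := norm_lift_le _ _

/-- Convolution on `ℓ¹(Γ)`. -/
def conv : L1 Γ →L[ℂ] L1 Γ →L[ℂ] L1 Γ :=
  lift shift norm_shift_le

theorem conv_delta_delta (a b : Γ) : conv (delta a) (delta b) = delta (a + b) := by
  rw [conv, lift_delta, shift, lift_delta]

theorem norm_conv_le (v w : L1 Γ) : ‖conv v w‖ ≤ ‖v‖ * ‖w‖ :=
  (ContinuousLinearMap.le_opNorm _ _).trans <| by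
    gcongr
    exact norm_lift_apply_le _ _ _

/-- The involution of `ℓ¹(Γ)` corresponding to complex conjugation of functions. -/
def conjA (w : L1 Γ) : L1 Γ :=
  ofSummable (fun a => starRingEnd ℂ (w (-a))) <| by
    simpa [Function.comp_def] using (Equiv.neg Γ).summable_iff.2 (hasSum_norm w).summable

theorem conjA_apply (w : L1 Γ) (a : Γ) : conjA w a = starRingEnd ℂ (w (-a)) := rfl

theorem conjA_sub (v w : L1 Γ) : conjA v - conjA w = conjA (v - w) :=
  L1.ext fun a => by simp [conjA_apply]

theorem norm_conjA (w : L1 Γ) : ‖conjA w‖ = ‖w‖ := by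
  refine (hasSum_norm _).unique ?_
  simpa [Function.comp_def, conjA_apply] using (Equiv.neg Γ).hasSum_iff.2 (hasSum_norm w)

theorem continuous_conjA : Continuous (conjA (Γ := Γ)) :=
  (Isometry.of_dist_eq fun v w => by
    rw [dist_eq_norm, dist_eq_norm, conjA_sub, norm_conjA]).continuous

/-- The character with frequency `a`. -/
def char (a x : ℝ) : ℂ := Complex.exp (Complex.I * a * x)

theorem norm_char (a x : ℝ) : ‖char a x‖ = 1 := by
  rw [char, Complex.norm_exp]
  simp

theorem char_add (a b x : ℝ) : char (a + b) x = char a x * char b x := by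
  simp only [char, ← Complex.exp_add]
  push_cast
  ring_nf

theorem char_neg (a x : ℝ) : char (-a) x = starRingEnd ℂ (char a x) := by
  simp only [char, ← Complex.exp_conj]
  simp

/-- The value at `x` of the almost periodic function with given Fourier coefficients. -/
def eval (x : ℝ) : L1 Γ →L[ℂ] ℂ := lift (fun a => char a x) fun a => (norm_char a x).le

theorem eval_apply (x : ℝ) (w : L1 Γ) : eval x w = ∑' a : Γ, w a * char a x := rfl

@[simp]
theorem eval_delta (x : ℝ) (a : Γ) : eval x (delta a) = char a x := lift_delta _ _ _

theorem norm_eval_le (x : ℝ) (w : L1 Γ) : ‖eval x w‖ ≤ ‖w‖ := norm_lift_apply_le _ _ _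

theorem eval_conv (x : ℝ) (v w : L1 Γ) : eval x (conv v w) = eval x v * eval x w := by
  have h1 (a : Γ) (w : L1 Γ) : eval x (conv (delta a) w) = char a x * eval x w := by
    have : (eval x).comp (conv (delta a)) = char a x • eval x :=
      clm_ext fun b => by simp [conv_delta_delta, char_add]
    simpa using DFunLike.congr_fun this w
  have h2 : (eval x).comp (conv.flip w) = eval x w • eval x :=
    clm_ext fun a => by simp [h1, mul_comm]
  simpa [mul_comm] using DFunLike.congr_fun h2 v

theorem eval_conjA (x : ℝ) (w : L1 Γ) : eval x (conjA w) = starRingEnd ℂ (eval x w) := by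
  rw [eval_apply, eval_apply, ← Equiv.tsum_eq (Equiv.neg Γ)]
  refine (tsum_congr fun a => ?_).trans (Complex.conj_tsum _).symm
  simp [conjA_apply, char_neg]

/-- The Fourier coefficients of `|u| ^ (2 k)` in terms of those of `u`. -/
def absPow : ℕ → L1 Γ → L1 Γ
  | 0, _ => delta 0
  | k + 1, w => conv (conv w (conjA w)) (absPow k w)

theorem eval_absPow (x : ℝ) (k : ℕ) (w : L1 Γ) :
    eval x (absPow k w) = ((‖eval x w‖ ^ (2 * k) : ℝ) : ℂ) := by
  induction k with
  | zero => simp [absPow, char]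
  | succ k ih =>
    rw [absPow, eval_conv, eval_conv, ih, eval_conjA, Complex.mul_conj, Complex.normSq_eq_norm_sq]
    push_cast
    ring

/-- Lipschitz continuity on every ball around the origin. -/
def LipOnBalls {E F : Type*} [NormedAddCommGroup E] [NormedAddCommGroup F] (G : E → F) : Prop :=
  ∀ R : ℝ, ∃ K : ℝ, 0 ≤ K ∧ ∀ v w, ‖v‖ ≤ R → ‖w‖ ≤ R → ‖G v - G w‖ ≤ K * ‖v - w‖

theorem LipOnBalls.exists_norm_le {E F : Type*} [NormedAddCommGroup E] [NormedAddCommGroup F]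
    {G : E → F} (hG : LipOnBalls G) (R : ℝ) : ∃ C : ℝ, 0 ≤ C ∧ ∀ v, ‖v‖ ≤ R → ‖G v‖ ≤ C := by
  by_cases hR : 0 ≤ R
  · obtain ⟨K, hK, h⟩ := hG R
    refine ⟨‖G 0‖ + K * R, by positivity, fun v hv => ?_⟩
    have h1 := h v 0 hv (by simpa using hR)
    rw [sub_zero] at h1
    have h2 : ‖G v‖ ≤ ‖G 0‖ + ‖G v - G 0‖ := norm_le_norm_add_norm_sub' _ _
    have h3 : K * ‖v‖ ≤ K * R := by gcongr
    linarith
  · exact ⟨0, le_rfl, fun v hv => absurd ((norm_nonneg v).trans hv) hR⟩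

/-- The product rule for differences: each factor is Lipschitz and bounded on the ball. -/
theorem LipOnBalls.conv {E : Type*} [NormedAddCommGroup E] {G H : E → L1 Γ} (hG : LipOnBalls G)
    (hH : LipOnBalls H) : LipOnBalls fun w => conv (G w) (H w) := by
  intro R
  obtain ⟨K, hK, hG'⟩ := hG R
  obtain ⟨L, hL, hH'⟩ := hH R
  obtain ⟨C, hC, hGC⟩ := hG.exists_norm_le R
  obtain ⟨D, hD, hHD⟩ := hH.exists_norm_le R
  refine ⟨K * D + C * L, by positivity, fun v w hv hw => ?_⟩
  have e : APNLS.conv (G v) (H v) - APNLS.conv (G w) (H w) =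
      APNLS.conv (G v - G w) (H v) + APNLS.conv (G w) (H v - H w) := by
    simp
  rw [e]
  calc _ ≤ ‖G v - G w‖ * ‖H v‖ + ‖G w‖ * ‖H v - H w‖ :=
        (norm_add_le _ _).trans (add_le_add (norm_conv_le _ _) (norm_conv_le _ _))
    _ ≤ (K * ‖v - w‖) * D + C * (L * ‖v - w‖) := by
        gcongr
        exacts [hG' v w hv hw, hHD v hv, hGC w hw, hH' v w hv hw]
    _ = _ := by ring

theorem lipOnBalls_absPow (k : ℕ) : LipOnBalls (absPow (Γ := Γ) k) := by
  induction k with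
  | zero => exact fun R => ⟨0, le_rfl, fun v w _ _ => by simp [absPow]⟩
  | succ k ih =>
    refine LipOnBalls.conv (LipOnBalls.conv (fun R => ⟨1, zero_le_one, fun v w _ _ => by simp⟩)
      fun R => ⟨1, zero_le_one, fun v w _ _ => ?_⟩) ih
    rw [conjA_sub, one_mul]
    exact (norm_conjA _).le

/-! ### The propagator on `ℓ¹(Γ)` and the vector field of the interaction picture -/

/-- The Fourier multiplier of the Schrödinger propagator. -/
def symbol (t a : ℝ) : ℂ := Complex.exp (-(Complex.I * (a : ℂ) ^ 2 * t))

theorem norm_symbol (t a : ℝ) : ‖symbol t a‖ = 1 := by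
  rw [symbol, Complex.norm_exp]
  simp [← Complex.ofReal_pow]

theorem symbol_add (s t a : ℝ) : symbol (s + t) a = symbol s a * symbol t a := by
  simp only [symbol, ← Complex.exp_add]
  push_cast
  ring_nf

/-- The Schrödinger propagator on `ℓ¹(Γ)`. -/
def prop (t : ℝ) : L1 Γ →L[ℂ] L1 Γ :=
  lift (fun a => symbol t a • delta a) fun a => by rw [norm_smul, norm_symbol, norm_delta, one_mul]

theorem norm_prop_le (t : ℝ) (w : L1 Γ) : ‖prop t w‖ ≤ ‖w‖ := norm_lift_apply_le _ _ _

theorem prop_prop (s t : ℝ) (w : L1 Γ) : prop s (prop t w) = prop (s + t) w := by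
  have : (prop s).comp (prop t) = prop (Γ := Γ) (s + t) :=
    clm_ext fun a => by simp [prop, symbol_add, smul_smul, mul_comm]
  exact DFunLike.congr_fun this w

@[simp]
theorem prop_zero (w : L1 Γ) : prop 0 w = w := by
  have : prop 0 = ContinuousLinearMap.id ℂ (L1 Γ) := clm_ext fun a => by simp [prop, symbol]
  exact DFunLike.congr_fun this w

theorem norm_prop (t : ℝ) (w : L1 Γ) : ‖prop t w‖ = ‖w‖ := by
  refine le_antisymm (norm_prop_le t w) ?_
  simpa [prop_prop] using norm_prop_le (-t) (prop t w)

theorem prop_apply (t : ℝ) (w : L1 Γ) (a : Γ) : prop t w a = symbol t a * w a := by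
  have : (coord a).comp (prop t) = symbol t a • coord a := clm_ext fun b => by
    by_cases h : a = b
    · subst h
      simp [prop, delta_apply_self]
    · simp [prop, delta_apply_ne h]
  exact DFunLike.congr_fun this w

theorem eval_prop (x t : ℝ) (w : L1 Γ) :
    eval x (prop t w) = ∑' a : Γ, w a * symbol t a * char a x := by
  rw [eval_apply]
  exact tsum_congr fun a => by rw [prop_apply]; ring

theorem continuous_prop (w : L1 Γ) : Continuous fun t : ℝ => prop t w := by
  simp only [prop, lift_apply]
  refine continuous_tsum (u := fun a => ‖w a‖) (fun a => ?_) (hasSum_norm w).summable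
    fun a t => ?_
  · unfold symbol
    fun_prop
  · rw [norm_smul, norm_smul, norm_symbol, norm_delta]
    simp

/-- Strong continuity in time and the isometry property, which is uniform in time, combine to joint
continuity. -/
theorem continuous_prop_uncurry : Continuous fun q : ℝ × L1 Γ => prop q.1 q.2 := by
  refine continuous_prod_of_continuous_lipschitzWith' _ 1 (fun t => ?_) continuous_prop
  refine LipschitzWith.of_dist_le_mul fun v w => ?_
  simp only [dist_eq_norm, ← map_sub, norm_prop]
  simp

theorem continuousOn_prop {X : Type*} [TopologicalSpace X] {a : X → ℝ} {b : X → L1 Γ} {s : Set X}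
    (ha : ContinuousOn a s) (hb : ContinuousOn b s) : ContinuousOn (fun x => prop (a x) (b x)) s := by
  have h := (continuous_prop_uncurry (Γ := Γ)).comp_continuousOn (ha.prodMk hb)
  exact h

theorem continuous_absPow (k : ℕ) : Continuous (absPow (Γ := Γ) k) := by
  induction k with
  | zero => exact continuous_const
  | succ k ih =>
    have h := continuous_conjA (Γ := Γ)
    change Continuous fun w : L1 Γ => conv (conv w (conjA w)) (absPow k w)
    fun_prop

/-- The vector field of the equation in the interaction picture. -/
def field (k : ℕ) (lam : ℂ) (t : ℝ) (w : L1 Γ) : L1 Γ :=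
  (-(Complex.I * lam)) • prop (-t) (absPow k (prop t w))

theorem continuousOn_field (k : ℕ) (lam : ℂ) {X : Type*} [TopologicalSpace X] {a : X → ℝ}
    {b : X → L1 Γ} {s : Set X} (ha : ContinuousOn a s) (hb : ContinuousOn b s) :
    ContinuousOn (fun x => field k lam (a x) (b x)) s := by
  have h := (continuous_absPow k).comp_continuousOn (continuousOn_prop ha hb)
  have h' := (continuousOn_prop ha.neg h).const_smul (-(Complex.I * lam))
  exact h'

theorem exists_lipschitz_field (k : ℕ) (lam : ℂ) (R : ℝ) : ∃ K : ℝ, 0 ≤ K ∧ ∀ (t : ℝ) (v w : L1 Γ),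
    ‖v‖ ≤ R → ‖w‖ ≤ R → ‖field k lam t v - field k lam t w‖ ≤ K * ‖v - w‖ := by
  obtain ⟨K, hK, h⟩ := lipOnBalls_absPow (Γ := Γ) k R
  refine ⟨‖lam‖ * K, by positivity, fun t v w hv hw => ?_⟩
  rw [field, field, ← smul_sub, ← map_sub, norm_smul, norm_prop, mul_assoc]
  have := h (prop t v) (prop t w) (by rwa [norm_prop]) (by rwa [norm_prop])
  rw [← map_sub, norm_prop] at this
  simp only [norm_neg, norm_mul, Complex.norm_I, one_mul]
  gcongr

theorem exists_norm_field_le (k : ℕ) (lam : ℂ) (R : ℝ) : ∃ C : ℝ, 0 ≤ C ∧ ∀ (t : ℝ) (v : L1 Γ),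
    ‖v‖ ≤ R → ‖field k lam t v‖ ≤ C := by
  obtain ⟨C, hC, h⟩ := (lipOnBalls_absPow (Γ := Γ) k).exists_norm_le R
  refine ⟨‖lam‖ * C, by positivity, fun t v hv => ?_⟩
  rw [field, norm_smul, norm_prop]
  simp only [norm_neg, norm_mul, Complex.norm_I, one_mul]
  gcongr
  exact h _ (by rwa [norm_prop])

end Algebra

/-! ### Mean values -/

/-- The average of `f` over `[-L, L]`. -/
def avg (f : ℝ → ℂ) (L : ℝ) : ℂ := ((1 / (2 * L) : ℝ) : ℂ) * ∫ x in (-L)..L, f x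

/-- `f` has the mean value `m`. -/
def HasMean (f : ℝ → ℂ) (m : ℂ) : Prop := Tendsto (avg f) atTop (𝓝 m)

theorem HasMean.meanValue_eq {f : ℝ → ℂ} {m : ℂ} (h : HasMean f m) : meanValue f = m :=
  Tendsto.limUnder_eq h

theorem HasMean.unique {f : ℝ → ℂ} {m m' : ℂ} (h : HasMean f m) (h' : HasMean f m') : m = m' :=
  tendsto_nhds_unique h h'

theorem norm_avg_le {f : ℝ → ℂ} {C L : ℝ} (hL : 0 < L) (hf : ∀ x, ‖f x‖ ≤ C) : ‖avg f L‖ ≤ C := by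
  have h := intervalIntegral.norm_integral_le_of_norm_le_const (a := -L) (b := L)
    fun x _ => hf x
  rw [avg, norm_mul, Complex.norm_real, Real.norm_of_nonneg (by positivity)]
  rw [abs_of_pos (by linarith)] at h
  calc 1 / (2 * L) * ‖∫ x in (-L)..L, f x‖ ≤ 1 / (2 * L) * (C * (L - -L)) := by gcongr
    _ = C := by field_simp; ring

theorem avg_const (c : ℂ) {L : ℝ} (hL : 0 < L) : avg (fun _ => c) L = c := by
  have : (L : ℂ) ≠ 0 := by exact_mod_cast hL.ne'
  rw [avg, intervalIntegral.integral_const, Complex.real_smul]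
  push_cast
  field_simp
  ring

theorem avg_add {f g : ℝ → ℂ} (hf : Continuous f) (hg : Continuous g) (L : ℝ) :
    avg (fun x => f x + g x) L = avg f L + avg g L := by
  rw [avg, intervalIntegral.integral_add (hf.intervalIntegrable _ _) (hg.intervalIntegrable _ _),
    mul_add]
  rfl

theorem avg_sub {f g : ℝ → ℂ} (hf : Continuous f) (hg : Continuous g) (L : ℝ) :
    avg (fun x => f x - g x) L = avg f L - avg g L := by
  rw [avg, intervalIntegral.integral_sub (hf.intervalIntegrable _ _) (hg.intervalIntegrable _ _),
    mul_sub]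
  rfl

theorem hasMean_const (c : ℂ) : HasMean (fun _ => c) c :=
  tendsto_const_nhds.congr' <| by
    filter_upwards [eventually_gt_atTop 0] with L hL using (avg_const c hL).symm

theorem HasMean.add {f g : ℝ → ℂ} {m n : ℂ} (hf : Continuous f) (hg : Continuous g)
    (hm : HasMean f m) (hn : HasMean g n) : HasMean (fun x => f x + g x) (m + n) :=
  (Tendsto.add hm hn).congr fun L => (avg_add hf hg L).symm

theorem HasMean.sub {f g : ℝ → ℂ} {m n : ℂ} (hf : Continuous f) (hg : Continuous g)
    (hm : HasMean f m) (hn : HasMean g n) : HasMean (fun x => f x - g x) (m - n) :=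
  (Tendsto.sub hm hn).congr fun L => (avg_sub hf hg L).symm

theorem HasMean.const_mul {f : ℝ → ℂ} {m : ℂ} (c : ℂ) (hm : HasMean f m) :
    HasMean (fun x => c * f x) (c * m) :=
  (Tendsto.const_mul c hm).congr fun L => by
    rw [avg, avg, intervalIntegral.integral_const_mul]
    ring

theorem HasMean.sum {ι : Type*} (s : Finset ι) {f : ι → ℝ → ℂ} {m : ι → ℂ}
    (hf : ∀ i ∈ s, Continuous (f i)) (hm : ∀ i ∈ s, HasMean (f i) (m i)) :
    HasMean (fun x => ∑ i ∈ s, f i x) (∑ i ∈ s, m i) := by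
  classical
  induction s using Finset.induction_on with
  | empty => simpa using hasMean_const 0
  | insert i s hi ih =>
    simp only [Finset.sum_insert hi]
    simp only [Finset.mem_insert, forall_eq_or_imp] at hf hm
    exact HasMean.add hf.1 (continuous_finsetSum _ hf.2) hm.1 (ih hf.2 hm.2)

theorem HasMean.of_approx {f : ℝ → ℂ} {m : ℂ} (hf : Continuous f)
    (h : ∀ ε > 0, ∃ (g : ℝ → ℂ) (m' : ℂ), Continuous g ∧ HasMean g m' ∧
      (∀ x, ‖f x - g x‖ ≤ ε) ∧ ‖m' - m‖ ≤ ε) : HasMean f m := by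
  refine Metric.tendsto_nhds.2 fun ε hε => ?_
  obtain ⟨g, m', hg, hm, hfg, hmm⟩ := h (ε / 4) (by positivity)
  filter_upwards [Metric.tendsto_nhds.1 hm (ε / 4) (by positivity), eventually_gt_atTop 0]
    with L h1 hL
  have h2 := norm_avg_le hL hfg
  rw [avg_sub hf hg] at h2
  rw [dist_eq_norm] at h1 ⊢
  have e : avg f L - m = (avg f L - avg g L) + (avg g L - m') + (m' - m) := by ring
  rw [e]
  linarith [norm_add₃_le (a := avg f L - avg g L) (b := avg g L - m') (c := m' - m)]

/-- The averages are Cauchy. Existence of the limit must be secured because `meanValue` is a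
`limUnder` and carries no information without it. -/
theorem exists_hasMean_of_approx {f : ℝ → ℂ} (hf : Continuous f)
    (h : ∀ ε > 0, ∃ (g : ℝ → ℂ) (m : ℂ), Continuous g ∧ HasMean g m ∧ ∀ x, ‖f x - g x‖ ≤ ε) :
    ∃ m, HasMean f m := by
  refine cauchySeq_tendsto_of_complete (Metric.cauchySeq_iff'.2 fun ε hε => ?_)
  obtain ⟨g, m, hg, hm, hfg⟩ := h (ε / 5) (by positivity)
  have hev : ∀ᶠ L in atTop, dist (avg f L) m < ε / 5 + ε / 5 := by
    filter_upwards [Metric.tendsto_nhds.1 hm (ε / 5) (by positivity), eventually_gt_atTop 0]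
      with L h1 hL
    have h2 := norm_avg_le hL hfg
    rw [avg_sub hf hg, ← dist_eq_norm] at h2
    linarith [dist_triangle (avg f L) (avg g L) m]
  obtain ⟨N, hN⟩ := eventually_atTop.1 hev
  exact ⟨N, fun L hL => by
    linarith [dist_triangle_right (avg f L) (avg f N) m, hN L hL, hN N le_rfl]⟩

theorem HasMean.le_re {f : ℝ → ℂ} {m : ℂ} {c : ℝ} (hf : Continuous f) (hm : HasMean f m)
    (hc : ∀ x, c ≤ (f x).re) : c ≤ m.re := by
  refine ge_of_tendsto ((Complex.continuous_re.tendsto m).comp hm) ?_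
  filter_upwards [eventually_gt_atTop 0] with L hL
  have h1 : ∫ _ in (-L)..L, c ≤ ∫ x in (-L)..L, (f x).re :=
    intervalIntegral.integral_mono_on (by linarith) (by simp)
      ((Complex.continuous_re.comp hf).intervalIntegrable _ _) fun x _ => hc x
  have h2 : ∫ x in (-L)..L, (f x).re = (∫ x in (-L)..L, f x).re :=
    Complex.reCLM.intervalIntegral_comp_comm (hf.intervalIntegrable _ _)
  rw [h2, intervalIntegral.integral_const, smul_eq_mul] at h1
  rw [Function.comp_apply, avg, Complex.re_ofReal_mul]
  calc c = 1 / (2 * L) * ((L - -L) * c) := by field_simp; ring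
    _ ≤ _ := by gcongr

theorem HasMean.im_eq_zero {f : ℝ → ℂ} {m : ℂ} (hf : Continuous f) (hm : HasMean f m)
    (h : ∀ x, (f x).im = 0) : m.im = 0 := by
  have h1 := (hm.const_mul Complex.I).le_re (c := 0) (by fun_prop) fun x => by simp [h]
  have h2 := (hm.const_mul (-Complex.I)).le_re (c := 0) (by fun_prop) fun x => by simp [h]
  simp at h1 h2
  linarith

/-- Shifting the window of integration changes the integral only by two end pieces of length `|s|`,
which the factor `1 / (2L)` kills. -/
theorem HasMean.translate {f : ℝ → ℂ} {m : ℂ} {B : ℝ} (hf : Continuous f) (hB : ∀ x, ‖f x‖ ≤ B)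
    (hm : HasMean f m) (s : ℝ) : HasMean (fun x => f (x + s)) m := by
  have hint (a b : ℝ) : IntervalIntegrable f MeasureTheory.volume a b := hf.intervalIntegrable a b
  have hdiff : Tendsto (fun L => avg (fun x => f (x + s)) L - avg f L) atTop (𝓝 0) := by
    have hlim : Tendsto (fun L : ℝ => 1 / (2 * L) * (2 * (B * |s|))) atTop (𝓝 0) := by
      have : Tendsto (fun L : ℝ => L⁻¹ * (B * |s|)) atTop (𝓝 (0 * (B * |s|))) :=
        tendsto_inv_atTop_zero.mul_const _
      rw [zero_mul] at this
      exact this.congr fun L => by field_simp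
    refine squeeze_zero_norm' ?_ hlim
    filter_upwards [eventually_gt_atTop 0] with L hL
    rw [avg, avg, ← mul_sub, intervalIntegral.integral_comp_add_right,
      intervalIntegral.integral_interval_sub_interval_comm' (hint _ _) (hint _ _) (hint _ _),
      norm_mul, Complex.norm_real, Real.norm_of_nonneg (by positivity)]
    gcongr
    have h1 := intervalIntegral.norm_integral_le_of_norm_le_const (a := L) (b := L + s)
      fun x _ => hB x
    have h2 := intervalIntegral.norm_integral_le_of_norm_le_const (a := -L) (b := -L + s)
      fun x _ => hB x
    simp only [add_sub_cancel_left] at h1 h2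
    linarith [norm_sub_le (∫ x in L..L + s, f x) (∫ x in (-L)..(-L + s), f x)]
  simpa [HasMean] using hdiff.add hm

theorem continuous_char (a : ℝ) : Continuous (char a) := by
  unfold char
  fun_prop

theorem continuous_mul_char {f : ℝ → ℂ} (hf : Continuous f) (a : ℝ) :
    Continuous fun x => f x * char a x := hf.mul (continuous_char a)

theorem char_zero (x : ℝ) : char 0 x = 1 := by simp [char]

theorem hasMean_char_of_ne {a : ℝ} (ha : a ≠ 0) : HasMean (char a) 0 := by
  have hlim : Tendsto (fun L : ℝ => 1 / (2 * L) * (2 / |a|)) atTop (𝓝 0) := by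
    have : Tendsto (fun L : ℝ => L⁻¹ * |a|⁻¹) atTop (𝓝 (0 * |a|⁻¹)) :=
      tendsto_inv_atTop_zero.mul_const _
    rw [zero_mul] at this
    exact this.congr fun L => by field_simp
  refine squeeze_zero_norm' ?_ hlim
  filter_upwards [eventually_gt_atTop 0] with L hL
  have hne : Complex.I * (a : ℂ) ≠ 0 := mul_ne_zero Complex.I_ne_zero (by exact_mod_cast ha)
  rw [avg, norm_mul, Complex.norm_real, Real.norm_of_nonneg (by positivity)]
  gcongr
  unfold char
  rw [integral_exp_mul_complex hne, norm_div, norm_mul, Complex.norm_I, one_mul, Complex.norm_real,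
    Real.norm_eq_abs]
  gcongr
  refine (norm_sub_le _ _).trans (le_of_eq ?_)
  have (y : ℝ) : ‖Complex.exp (Complex.I * a * y)‖ = 1 := norm_char a y
  rw [this, this]
  norm_num

theorem hasMean_char (a : ℝ) : HasMean (char a) (if a = 0 then 1 else 0) := by
  split_ifs with h
  · subst h
    simpa [funext char_zero] using hasMean_const 1
  · exact hasMean_char_of_ne h

/-! ### Almost periodic functions -/

theorem trigPoly_eq (c : ℝ →₀ ℂ) (x : ℝ) : trigPoly c x = ∑ a ∈ c.support, c a * char a x := rfl

theorem continuous_trigPoly (c : ℝ →₀ ℂ) : Continuous (trigPoly c) := by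
  have := continuous_char
  change Continuous fun x => ∑ a ∈ c.support, c a * char a x
  fun_prop

theorem trigPoly_add (c d : ℝ →₀ ℂ) (x : ℝ) : trigPoly (c + d) x = trigPoly c x + trigPoly d x :=
  Finsupp.sum_add_index' (fun _ => by simp) fun _ _ _ => by ring

theorem trigPoly_sub (c d : ℝ →₀ ℂ) (x : ℝ) : trigPoly (c - d) x = trigPoly c x - trigPoly d x :=
  Finsupp.sum_sub_index fun _ _ _ => by ring

theorem trigPoly_single (a : ℝ) (z : ℂ) (x : ℝ) :
    trigPoly (Finsupp.single a z) x = z * char a x :=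
  Finsupp.sum_single_index (by simp)

theorem trigPoly_sum {ι : Type*} (s : Finset ι) (c : ι → ℝ →₀ ℂ) (x : ℝ) :
    trigPoly (∑ i ∈ s, c i) x = ∑ i ∈ s, trigPoly (c i) x := by
  classical
  induction s using Finset.induction_on with
  | empty => simp [trigPoly]
  | insert i s hi ih => rw [Finset.sum_insert hi, Finset.sum_insert hi, trigPoly_add, ih]

namespace IsAlmostPeriodic

variable {f g : ℝ → ℂ}

theorem continuous (hf : IsAlmostPeriodic f) : Continuous f := by
  refine continuous_of_uniform_approx_of_continuous fun U hU => ?_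
  obtain ⟨ε, hε, h⟩ := Metric.mem_uniformity_dist.1 hU
  obtain ⟨c, hc⟩ := hf ε hε
  exact ⟨_, continuous_trigPoly c, fun x => h (by rw [dist_eq_norm]; exact hc x)⟩

theorem exists_bound (hf : IsAlmostPeriodic f) : ∃ B : ℝ, 0 < B ∧ ∀ x, ‖f x‖ ≤ B := by
  obtain ⟨c, hc⟩ := hf 1 one_pos
  refine ⟨1 + ∑ a ∈ c.support, ‖c a‖, by positivity, fun x => ?_⟩
  have h1 : ‖trigPoly c x‖ ≤ ∑ a ∈ c.support, ‖c a‖ := by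
    rw [trigPoly_eq]
    exact norm_sum_le_of_le _ fun a _ => by simp [norm_char]
  linarith [hc x, norm_le_norm_add_norm_sub' (f x) (trigPoly c x)]

theorem sub (hf : IsAlmostPeriodic f) (hg : IsAlmostPeriodic g) :
    IsAlmostPeriodic fun x => f x - g x := by
  intro ε hε
  obtain ⟨c, hc⟩ := hf (ε / 2) (by positivity)
  obtain ⟨d, hd⟩ := hg (ε / 2) (by positivity)
  refine ⟨c - d, fun x => ?_⟩
  rw [trigPoly_sub, sub_sub_sub_comm]
  linarith [norm_sub_le (f x - trigPoly c x) (g x - trigPoly d x), hc x, hd x]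

end IsAlmostPeriodic

theorem hasMean_trigPoly_mul_char (c : ℝ →₀ ℂ) (a : ℝ) :
    HasMean (fun x => trigPoly c x * char a x)
      (∑ b ∈ c.support, c b * if b + a = 0 then 1 else 0) := by
  have h := HasMean.sum c.support (f := fun b x => c b * char (b + a) x)
    (fun b _ => (continuous_char _).const_mul _) fun b _ => (hasMean_char (b + a)).const_mul (c b)
  convert h using 2 with x
  rw [trigPoly_eq, Finset.sum_mul]
  exact Finset.sum_congr rfl fun b _ => by rw [char_add, mul_assoc]

theorem fourierCoeffAP_eq (f : ℝ → ℂ) (a : ℝ) :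
    fourierCoeffAP f a = meanValue fun x => f x * char (-a) x := by
  simp [fourierCoeffAP, char]

theorem fourierCoeffAP_zero (f : ℝ → ℂ) : fourierCoeffAP f 0 = meanValue f := by
  simp [fourierCoeffAP]

theorem IsAlmostPeriodic.hasMean_mul_char {f : ℝ → ℂ} (hf : IsAlmostPeriodic f) (a : ℝ) :
    HasMean (fun x => f x * char (-a) x) (fourierCoeffAP f a) := by
  obtain ⟨m, hm⟩ : ∃ m, HasMean (fun x => f x * char (-a) x) m := by
    refine exists_hasMean_of_approx (continuous_mul_char hf.continuous _) fun ε hε => ?_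
    obtain ⟨c, hc⟩ := hf ε hε
    refine ⟨_, _, continuous_mul_char (continuous_trigPoly c) _,
      hasMean_trigPoly_mul_char c (-a), fun x => ?_⟩
    rw [← sub_mul, norm_mul, norm_char, mul_one]
    exact (hc x).le
  rwa [fourierCoeffAP_eq, hm.meanValue_eq]

theorem IsAlmostPeriodic.fourierCoeffAP_sub {f g : ℝ → ℂ} (hf : IsAlmostPeriodic f)
    (hg : IsAlmostPeriodic g) (a : ℝ) :
    fourierCoeffAP (fun x => f x - g x) a = fourierCoeffAP f a - fourierCoeffAP g a := by
  refine ((hf.sub hg).hasMean_mul_char a).unique ?_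
  have := (hf.hasMean_mul_char a).sub (continuous_mul_char hf.continuous _)
    (continuous_mul_char hg.continuous _) (hg.hasMean_mul_char a)
  simpa only [← sub_mul] using this

/-- The translates of an almost periodic function form a totally bounded set. -/
theorem IsAlmostPeriodic.exists_finset_translates {f : ℝ → ℂ} (hf : IsAlmostPeriodic f) {ε : ℝ}
    (hε : 0 < ε) :
    ∃ T : Finset ℝ, ∀ τ : ℝ, ∃ σ ∈ T, ∀ x, ‖f (x + τ) - f (x + σ)‖ ≤ ε := by
  classical
  obtain ⟨c, hc⟩ := hf (ε / 3) (by positivity)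
  set A : ℝ := ∑ a ∈ c.support, ‖c a‖ with hA
  have hA0 : 0 ≤ A := by positivity
  -- A translate of the approximating polynomial depends on `τ` only through the finitely many
  -- unimodular numbers `e^{iaτ}`, a point of a compact ball.
  set φ : ℝ → (c.support → ℂ) := fun τ a => char a τ with hφ
  have htb : TotallyBounded (Set.range φ) := by
    refine (isCompact_closedBall (0 : c.support → ℂ) 1).totallyBounded.subset ?_
    rintro _ ⟨τ, rfl⟩
    rw [mem_closedBall_zero_iff]
    exact (pi_norm_le_iff_of_nonneg zero_le_one).2 fun a => (norm_char _ _).le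
  -- The mesh makes two translates of the polynomial differ by at most `ε / 3`; `A + 1` in place of
  -- `A` covers the zero polynomial.
  obtain ⟨k, hkφ, hfin, hk⟩ := htb.exists_subset
    (Metric.dist_mem_uniformity (show (0 : ℝ) < ε / (3 * (A + 1)) by positivity))
  refine ⟨hfin.toFinset.image (Function.invFun φ), fun τ => ?_⟩
  obtain ⟨y, hy, hτ⟩ := Set.mem_iUnion₂.1 (hk (Set.mem_range_self τ))
  refine ⟨Function.invFun φ y, Finset.mem_image_of_mem _ (hfin.mem_toFinset.2 hy), fun x => ?_⟩
  set σ := Function.invFun φ y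
  have hσ : φ σ = y := Function.invFun_eq (hkφ hy)
  have hdist : dist (φ τ) (φ σ) < ε / (3 * (A + 1)) := by rw [hσ]; exact hτ
  have hP : ‖trigPoly c (x + τ) - trigPoly c (x + σ)‖ ≤ ε / 3 := by
    rw [trigPoly_eq, trigPoly_eq, ← Finset.sum_sub_distrib]
    calc ‖∑ a ∈ c.support, (c a * char a (x + τ) - c a * char a (x + σ))‖
        ≤ ∑ a ∈ c.support, ‖c a‖ * (ε / (3 * (A + 1))) := norm_sum_le_of_le _ fun a ha => by
          have h1 (t : ℝ) : char a (x + t) = char a x * char a t := by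
            simp only [char, ← Complex.exp_add]
            push_cast
            ring_nf
          rw [← mul_sub, norm_mul, h1, h1, ← mul_sub, norm_mul, norm_char, one_mul]
          gcongr
          have h2 := (dist_le_pi_dist (φ τ) (φ σ) ⟨a, ha⟩).trans hdist.le
          rwa [dist_eq_norm] at h2
      _ = A / (A + 1) * (ε / 3) := by
          rw [← Finset.sum_mul, ← hA]
          field_simp
      _ ≤ 1 * (ε / 3) := by
          gcongr
          rw [div_le_one (by positivity)]
          linarith
      _ = ε / 3 := one_mul _
  have e : f (x + τ) - f (x + σ) = (f (x + τ) - trigPoly c (x + τ)) +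
      (trigPoly c (x + τ) - trigPoly c (x + σ)) - (f (x + σ) - trigPoly c (x + σ)) := by ring
  rw [e]
  refine (norm_sub_le _ _).trans ?_
  linarith [norm_add_le (f (x + τ) - trigPoly c (x + τ))
    (trigPoly c (x + τ) - trigPoly c (x + σ)), hc (x + τ), hc (x + σ)]

/-- Replacing one factor of `f · conj f` by a trigonometric polynomial leaves a finite combination
of Fourier coefficients of `f`, all zero, at a uniformly small cost. -/
theorem IsAlmostPeriodic.hasMean_norm_sq {f : ℝ → ℂ} (hf : IsAlmostPeriodic f)
    (h0 : ∀ a, fourierCoeffAP f a = 0) : HasMean (fun x => ((‖f x‖ ^ 2 : ℝ) : ℂ)) 0 := by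
  obtain ⟨B, hB0, hB⟩ := hf.exists_bound
  have hfc := hf.continuous
  refine HasMean.of_approx (by fun_prop) fun ε hε => ?_
  obtain ⟨c, hc⟩ := hf (ε / B) (by positivity)
  have hmean : HasMean (fun x => f x * starRingEnd ℂ (trigPoly c x)) 0 := by
    have h := HasMean.sum c.support (f := fun a x => starRingEnd ℂ (c a) * (f x * char (-a) x))
      (fun a _ => (continuous_mul_char hfc _).const_mul _)
      fun a _ => (hf.hasMean_mul_char a).const_mul (starRingEnd ℂ (c a))
    simp only [h0, mul_zero, Finset.sum_const_zero] at h
    convert h using 2 with x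
    rw [trigPoly_eq, map_sum, Finset.mul_sum]
    refine Finset.sum_congr rfl fun a _ => ?_
    rw [map_mul, char_neg]
    ring
  refine ⟨_, 0, hfc.mul (continuous_trigPoly c).star, hmean, fun x => ?_, by simpa using hε.le⟩
  have e : ((‖f x‖ ^ 2 : ℝ) : ℂ) - f x * starRingEnd ℂ (trigPoly c x) =
      f x * starRingEnd ℂ (f x - trigPoly c x) := by
    rw [map_sub, mul_sub, Complex.mul_conj, Complex.normSq_eq_norm_sq]
  change ‖((‖f x‖ ^ 2 : ℝ) : ℂ) - f x * starRingEnd ℂ (trigPoly c x)‖ ≤ ε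
  rw [e, norm_mul, RCLike.norm_conj]
  calc ‖f x‖ * ‖f x - trigPoly c x‖ ≤ B * (ε / B) := by
        gcongr
        exacts [hB x, (hc x).le]
    _ = ε := by field_simp

/-- An almost periodic function is determined by its Fourier coefficients. -/
theorem IsAlmostPeriodic.eq_zero {f : ℝ → ℂ} (hf : IsAlmostPeriodic f)
    (h0 : ∀ a, fourierCoeffAP f a = 0) (x : ℝ) : f x = 0 := by
  by_contra hx
  have hd : 0 < ‖f x‖ := norm_pos_iff.2 hx
  obtain ⟨B, hB0, hB⟩ := hf.exists_bound
  have hfc := hf.continuous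
  obtain ⟨T, hT⟩ := hf.exists_finset_translates (half_pos hd)
  set g : ℝ → ℂ := fun x => ((‖f x‖ ^ 2 : ℝ) : ℂ) with hg
  have hgc : Continuous g := by fun_prop
  have hgB (y : ℝ) : ‖g y‖ ≤ B ^ 2 := by
    rw [hg, Complex.norm_real, Real.norm_of_nonneg (by positivity)]
    have := hB y
    gcongr
  -- At each `τ`, some `σ ∈ T` has `|f(τ + x - σ)| ≥ |f x| / 2`. So this finite sum of translates of
  -- `|f|²` is bounded below by a positive constant, although its mean is `0`.
  have hmean := HasMean.sum T (f := fun σ y => g (y + (x - σ)))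
    (fun σ _ => hgc.comp (continuous_id.add continuous_const))
    fun σ _ => (hf.hasMean_norm_sq h0).translate hgc hgB (x - σ)
  have hle := hmean.le_re (c := (‖f x‖ / 2) ^ 2)
    (continuous_finsetSum _ fun σ _ => hgc.comp (continuous_id.add continuous_const)) fun τ => by
      obtain ⟨σ, hσ, h⟩ := hT τ
      have h1 := h (x - σ)
      rw [sub_add_cancel, norm_sub_rev] at h1
      have h2 := norm_sub_norm_le (f x) (f (x - σ + τ))
      have h3 : ‖f x‖ / 2 ≤ ‖f (τ + (x - σ))‖ := by
        rw [add_comm τ]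
        linarith
      rw [Complex.re_sum]
      calc (‖f x‖ / 2) ^ 2 ≤ (g (τ + (x - σ))).re := by
            rw [hg, Complex.ofReal_re]
            gcongr
        _ ≤ _ := Finset.single_le_sum (f := fun σ => (g (τ + (x - σ))).re)
            (fun i _ => by rw [hg, Complex.ofReal_re]; positivity) hσ
  simp only [Finset.sum_const_zero, Complex.zero_re] at hle
  have : 0 < (‖f x‖ / 2) ^ 2 := by positivity
  linarith

/-! ### The space `A_ω` as `ℓ¹` -/

section Eval

variable {Γ : AddSubgroup ℝ}

open L1

theorem exists_trigPoly_eval (w : L1 Γ) {ε : ℝ} (hε : 0 < ε) : ∃ s : Finset Γ,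
    ‖w - ∑ a ∈ s, w a • delta a‖ < ε ∧ ∀ x, eval x (∑ a ∈ s, w a • delta a) =
      ∑ a ∈ s, w a * char a x := by
  obtain ⟨s, hs⟩ := ((Metric.tendsto_nhds.1 (hasSum_delta w)) ε hε).exists
  refine ⟨s, ?_, fun x => by simp⟩
  rw [← dist_eq_norm, dist_comm]
  exact hs

theorem isAlmostPeriodic_eval (w : L1 Γ) : IsAlmostPeriodic fun x => eval x w := by
  intro ε hε
  obtain ⟨s, hs, he⟩ := exists_trigPoly_eval w hε
  refine ⟨∑ a ∈ s, Finsupp.single (a : ℝ) (w a), fun x => ?_⟩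
  have : trigPoly (∑ a ∈ s, Finsupp.single (a : ℝ) (w a)) x =
      eval x (∑ a ∈ s, w a • delta a) := by
    rw [trigPoly_sum, he]
    simp only [trigPoly_single]
  rw [this, ← map_sub]
  exact (norm_eval_le _ _).trans_lt hs

/-- The hypothesis compares the coefficient at `b` of each finite truncation with `m`. It covers
both `b ∈ Γ` and `b ∉ Γ`. -/
theorem hasMean_eval_mul_char (w : L1 Γ) (b : ℝ) {m : ℂ}
    (hm : ∀ s : Finset Γ, ‖(∑ a ∈ s, w a * if (a : ℝ) + -b = 0 then 1 else 0) - m‖ ≤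
      ‖w - ∑ a ∈ s, w a • delta a‖) :
    HasMean (fun x => eval x w * char (-b) x) m := by
  refine HasMean.of_approx (continuous_mul_char (isAlmostPeriodic_eval w).continuous _)
    fun ε hε => ?_
  obtain ⟨s, hs, he⟩ := exists_trigPoly_eval w hε
  have h := HasMean.sum s (f := fun a x => w a * char (a + -b) x)
    (fun a _ => (continuous_char _).const_mul _) fun a _ => (hasMean_char (a + -b)).const_mul (w a)
  refine ⟨_, _, continuous_finsetSum _ fun a _ => (continuous_char _).const_mul _, h, fun x => ?_,
    (hm s).trans hs.le⟩
  have : ∑ a ∈ s, w a * char (a + -b) x = eval x (∑ a ∈ s, w a • delta a) * char (-b) x := by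
    rw [he, Finset.sum_mul]
    exact Finset.sum_congr rfl fun a _ => by rw [char_add, mul_assoc]
  change ‖eval x w * char (-b) x - ∑ a ∈ s, w a * char (a + -b) x‖ ≤ ε
  rw [this, ← sub_mul, norm_mul, norm_char, mul_one, ← map_sub]
  exact (norm_eval_le _ _).trans hs.le

theorem fourierCoeffAP_eval (w : L1 Γ) (b : Γ) : fourierCoeffAP (fun x => eval x w) b = w b := by
  rw [fourierCoeffAP_eq]
  refine (hasMean_eval_mul_char w b fun s => ?_).meanValue_eq
  rw [norm_sub_rev]
  have h := norm_apply_le (w - ∑ a ∈ s, w a • delta a) b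
  have e : coord b (∑ a ∈ s, w a • delta a) = ∑ a ∈ s, w a * if (a : ℝ) + -b = 0 then 1 else 0 := by
    rw [map_sum]
    refine Finset.sum_congr rfl fun a _ => ?_
    rw [map_smul, coord_apply, smul_eq_mul]
    by_cases hab : b = a
    · subst hab
      simp [delta_apply_self]
    · have : ¬ (a : ℝ) + -b = 0 := fun h => hab (Subtype.ext (by linarith))
      simp [delta_apply_ne hab, this]
  rwa [← coord_apply, map_sub, e, coord_apply] at h

theorem fourierCoeffAP_eval_of_notMem (w : L1 Γ) {b : ℝ} (hb : b ∉ Γ) :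
    fourierCoeffAP (fun x => eval x w) b = 0 := by
  rw [fourierCoeffAP_eq]
  refine (hasMean_eval_mul_char w b fun s => ?_).meanValue_eq
  have (a : Γ) : ¬ (a : ℝ) + -b = 0 := fun h => hb (by
    rw [← sub_eq_add_neg, sub_eq_zero] at h
    rw [← h]
    exact a.2)
  simp [this]

theorem eval_injective {v w : L1 Γ} (h : ∀ x, eval x v = eval x w) : v = w :=
  L1.ext fun a => by
    rw [← fourierCoeffAP_eval v a, ← fourierCoeffAP_eval w a, funext h]

theorem meanValue_eval (w : L1 Γ) : meanValue (fun x => eval x w) = w 0 := by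
  rw [← fourierCoeffAP_zero, ← fourierCoeffAP_eval]
  rfl

theorem hasMean_eval (w : L1 Γ) : HasMean (fun x => eval x w) (w 0) := by
  have h := (isAlmostPeriodic_eval w).hasMean_mul_char 0
  simpa [char_zero, fourierCoeffAP_zero, meanValue_eval] using h

end Eval

/-- The group of admissible frequencies. -/
def freqGroup (ω : ℕ → ℝ) : AddSubgroup ℝ :=
  (Finsupp.liftAddHom fun j => (AddMonoidHom.mulRight (ω j)).comp (Int.castAddHom ℝ)).range

section MemA

variable {ω : ℕ → ℝ}

open L1

/-- The carrier of `freqGroup ω` unfolds to `freqSet ω`, so the two index types agree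
definitionally. -/
theorem tsum_freqSet {E : Type*} [AddCommMonoid E] [TopologicalSpace E] (F : ℝ → E) :
    ∑' a : freqSet ω, F a = ∑' a : freqGroup ω, F a := rfl

theorem normA_eval (w : L1 (freqGroup ω)) : normA ω (fun x => eval x w) = ‖w‖ₑ := by
  rw [normA, tsum_freqSet fun a => ‖fourierCoeffAP (fun x => eval x w) a‖ₑ]
  simp only [fourierCoeffAP_eval]
  simp only [← ofReal_norm]
  rw [← (hasSum_norm w).tsum_eq,
    ENNReal.ofReal_tsum_of_nonneg (fun _ => norm_nonneg _) (hasSum_norm w).summable]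

theorem memA_eval (w : L1 (freqGroup ω)) : MemA ω fun x => eval x w where
  almostPeriodic := isAlmostPeriodic_eval w
  freq_mem a ha := by
    by_contra h
    exact ha (fourierCoeffAP_eval_of_notMem w h)
  norm_lt_top := by
    rw [normA_eval]
    exact enorm_lt_top

theorem MemA.exists_eval {f : ℝ → ℂ} (hf : MemA ω f) :
    ∃ w : L1 (freqGroup ω), f = fun x => eval x w := by
  have hsum : Summable fun a : freqGroup ω => ‖fourierCoeffAP f a‖ := by
    have h := hf.norm_lt_top.ne
    rw [normA, tsum_freqSet fun a => ‖fourierCoeffAP f a‖ₑ] at h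
    simpa using ENNReal.summable_toReal h
  set w : L1 (freqGroup ω) := ofSummable _ hsum with hw
  refine ⟨w, funext fun x => ?_⟩
  rw [← sub_eq_zero]
  have hw' := isAlmostPeriodic_eval w
  refine (hf.almostPeriodic.sub hw').eq_zero (fun a => ?_) x
  rw [hf.almostPeriodic.fourierCoeffAP_sub hw']
  by_cases ha : a ∈ freqGroup ω
  · have := fourierCoeffAP_eval w ⟨a, ha⟩
    rw [this, hw, ofSummable_apply, sub_self]
  · rw [fourierCoeffAP_eval_of_notMem w ha, sub_zero]
    by_contra h
    exact ha (hf.freq_mem a h)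

theorem propagator_eval (t : ℝ) (w : L1 (freqGroup ω)) (x : ℝ) :
    propagator ω t (fun y => eval y w) x = eval x (prop t w) := by
  rw [propagator, tsum_freqSet fun a => fourierCoeffAP (fun y => eval y w) a *
    Complex.exp (-(Complex.I * (a : ℂ) ^ 2 * t)) * Complex.exp (Complex.I * a * x), eval_prop]
  simp only [fourierCoeffAP_eval]
  rfl

end MemA

/-! ### Continuation of solutions of ordinary differential equations -/

section ODE

variable {E : Type*} [NormedAddCommGroup E]

/-- A vector field that is continuous in time and, on every ball and uniformly in time, bounded and
Lipschitz continuous. -/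
structure IsTameField (F : ℝ → E → E) : Prop where
  continuous_time : ∀ x, Continuous fun t => F t x
  lip : ∀ R : ℝ, ∃ K : ℝ, 0 ≤ K ∧ ∀ t v w, ‖v‖ ≤ R → ‖w‖ ≤ R → ‖F t v - F t w‖ ≤ K * ‖v - w‖
  bound : ∀ R : ℝ, ∃ C : ℝ, 0 ≤ C ∧ ∀ t v, ‖v‖ ≤ R → ‖F t v‖ ≤ C

theorem IsTameField.reverse {F : ℝ → E → E} (hF : IsTameField F) :
    IsTameField fun t x => -F (-t) x where
  continuous_time x := ((hF.continuous_time x).comp continuous_neg).neg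
  lip R := by
    obtain ⟨K, hK, h⟩ := hF.lip R
    refine ⟨K, hK, fun t v w hv hw => ?_⟩
    rw [neg_sub_neg, norm_sub_rev]
    exact h _ _ _ hv hw
  bound R := by
    obtain ⟨C, hC, h⟩ := hF.bound R
    exact ⟨C, hC, fun t v hv => by rw [norm_neg]; exact h _ _ hv⟩

theorem IsTameField.lipschitzOnWith {F : ℝ → E → E} (hF : IsTameField F) (R : ℝ) :
    ∃ K : NNReal, ∀ t, LipschitzOnWith K (F t) (Metric.closedBall 0 R) := by
  obtain ⟨K, hK, h⟩ := hF.lip R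
  refine ⟨⟨K, hK⟩, fun t => LipschitzOnWith.of_dist_le_mul fun v hv w hw => ?_⟩
  rw [dist_eq_norm, dist_eq_norm]
  exact h t v w (by simpa using hv) (by simpa using hw)

variable [NormedSpace ℝ E]

/-- Picard–Lindelöf on the unit ball around `x₀`. What matters is that `δ` is chosen before `t₀` and
`x₀` and depends on `R` alone. -/
theorem IsTameField.exists_local_solution [CompleteSpace E] {F : ℝ → E → E} (hF : IsTameField F)
    (R : ℝ) : ∃ δ > 0, ∀ (t₀ : ℝ) (x₀ : E), ‖x₀‖ ≤ R → ∃ z : ℝ → E, z t₀ = x₀ ∧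
      ∀ t ∈ Set.Ioo (t₀ - δ) (t₀ + δ), HasDerivAt z (F t (z t)) t := by
  obtain ⟨K, hK⟩ := hF.lipschitzOnWith (R + 1)
  obtain ⟨C, hC, hb⟩ := hF.bound (R + 1)
  lift C to NNReal using hC
  -- With speed at most `C` the curve cannot leave the unit ball within this time; the `+ 1` covers
  -- `C = 0`.
  refine ⟨1 / (C + 1), by positivity, fun t₀ x₀ hx₀ => ?_⟩
  set δ : ℝ := 1 / (C + 1) with hδ
  have hδ0 : 0 < δ := by positivity
  have hsub : Metric.closedBall x₀ ((1 : NNReal) : ℝ) ⊆ Metric.closedBall 0 (R + 1) := by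
    refine Metric.closedBall_subset_closedBall' ?_
    rw [dist_zero_right]
    simpa [add_comm] using hx₀
  have hP : IsPicardLindelof F (tmin := t₀ - δ) (tmax := t₀ + δ) ⟨t₀, by constructor <;> linarith⟩
      x₀ 1 0 C K :=
    { lipschitzOnWith := fun t _ => (hK t).mono hsub
      continuousOn := fun x _ => (hF.continuous_time x).continuousOn
      norm_le := fun t _ x hx => hb t x (by simpa using hsub hx)
      mul_max_le := by
        have : C * δ ≤ 1 := by
          rw [hδ, mul_one_div, div_le_one (by positivity)]
          linarith
        simpa using this }
  obtain ⟨z, hz0, hz⟩ := hP.exists_eq_forall_mem_Icc_hasDerivWithinAt₀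
  exact ⟨z, hz0, fun t ht => (hz t (Set.Ioo_subset_Icc_self ht)).hasDerivAt (Icc_mem_nhds ht.1 ht.2)⟩

theorem IsTameField.eqOn_Ico {F : ℝ → E → E} (hF : IsTameField F) {a b : ℝ} {v w : ℝ → E}
    (hv : ∀ t ∈ Set.Ico a b, HasDerivAt v (F t (v t)) t)
    (hw : ∀ t ∈ Set.Ico a b, HasDerivAt w (F t (w t)) t) (h : v a = w a) :
    Set.EqOn v w (Set.Ico a b) := by
  intro t ht
  have hsub : Set.Icc a t ⊆ Set.Ico a b := Set.Icc_subset_Ico_right ht.2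
  have hvc : ContinuousOn v (Set.Icc a t) := HasDerivAt.continuousOn fun s hs => hv s (hsub hs)
  have hwc : ContinuousOn w (Set.Icc a t) := HasDerivAt.continuousOn fun s hs => hw s (hsub hs)
  obtain ⟨A, hA⟩ := isCompact_Icc.exists_bound_of_continuousOn hvc
  obtain ⟨B, hB⟩ := isCompact_Icc.exists_bound_of_continuousOn hwc
  obtain ⟨K, hK⟩ := hF.lipschitzOnWith (max A B)
  refine ODE_solution_unique_of_mem_Icc_right (v := F)
    (s := fun _ => Metric.closedBall 0 (max A B)) (fun s _ => hK s) hvc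
    (fun s hs => (hv s (hsub (Set.Ico_subset_Icc_self hs))).hasDerivWithinAt) ?_ hwc
    (fun s hs => (hw s (hsub (Set.Ico_subset_Icc_self hs))).hasDerivWithinAt) ?_ h
    ⟨ht.1, le_rfl⟩
  · intro s hs
    simpa using Or.inl (hA s (Set.Ico_subset_Icc_self hs))
  · intro s hs
    simpa using Or.inr (hB s (Set.Ico_subset_Icc_self hs))

theorem IsTameField.exists_extension_right [CompleteSpace E] {F : ℝ → E → E} (hF : IsTameField F)
    {b R : ℝ} {w : ℝ → E} (hw : ∀ᶠ t in 𝓝[<] b, HasDerivAt w (F t (w t)) t)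
    (hR : ∃ᶠ t in 𝓝[<] b, ‖w t‖ ≤ R) :
    ∃ δ > 0, ∃ v : ℝ → E, (∀ t < b, v t = w t) ∧
      ∀ t ∈ Set.Ico b (b + δ), HasDerivAt v (F t (v t)) t := by
  obtain ⟨δ, hδ, hloc⟩ := hF.exists_local_solution R
  obtain ⟨a, hab, ha⟩ := (mem_nhdsLT_iff_exists_Ioo_subset).1 hw
  have hnear : ∀ᶠ t in 𝓝[<] b, max a (b - δ) < t ∧ t < b :=
    Ioo_mem_nhdsLT (max_lt hab (by linarith))
  obtain ⟨t₀, hR₀, h₀, h₀b⟩ := (hR.and_eventually hnear).exists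
  obtain ⟨h₀a, h₀δ⟩ := max_lt_iff.1 h₀
  obtain ⟨z, hz₀, hz⟩ := hloc t₀ (w t₀) hR₀
  have heq : Set.EqOn w z (Set.Ico t₀ b) :=
    hF.eqOn_Ico (fun t ht => ha ⟨h₀a.trans_le ht.1, ht.2⟩)
      (fun t ht => hz t ⟨by linarith [ht.1], by linarith [ht.2]⟩) hz₀.symm
  -- From `t₀` on the glued curve is `z` itself, so it is differentiable at the junction `b`.
  have hvz : ∀ t, t₀ ≤ t → (if t < b then w t else z t) = z t := fun t ht => by
    split_ifs with h
    exacts [heq ⟨ht, h⟩, rfl]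
  refine ⟨t₀ + δ - b, by linarith, fun t => if t < b then w t else z t,
    fun t ht => if_pos ht, fun t ht => ?_⟩
  have ht₀ : t₀ < t := h₀b.trans_le ht.1
  have hzt := hz t ⟨by linarith, by linarith [ht.2]⟩
  simp only [hvz t ht₀.le]
  refine hzt.congr_of_eventuallyEq ?_
  filter_upwards [Ioi_mem_nhds ht₀] with s hs using hvz s (le_of_lt hs)

theorem IsTameField.exists_extension_left [CompleteSpace E] {F : ℝ → E → E} (hF : IsTameField F)
    {b R : ℝ} {w : ℝ → E} (hw : ∀ᶠ t in 𝓝[>] b, HasDerivAt w (F t (w t)) t)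
    (hR : ∃ᶠ t in 𝓝[>] b, ‖w t‖ ≤ R) :
    ∃ δ > 0, ∃ v : ℝ → E, (∀ t > b, v t = w t) ∧
      ∀ t ∈ Set.Ioc (b - δ) b, HasDerivAt v (F t (v t)) t := by
  have hneg : Tendsto (fun t : ℝ => -t) (𝓝[<] (-b)) (𝓝[>] b) := by
    simpa using tendsto_neg_nhdsLT (a := -b)
  have hrev {g : ℝ → E} {g' : E} {t : ℝ} (h : HasDerivAt g g' (-t)) :
      HasDerivAt (fun s => g (-s)) (-g') t := by
    simpa [Function.comp_def] using h.scomp t (hasDerivAt_neg t)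
  obtain ⟨δ, hδ, v, hvw, hv⟩ := hF.reverse.exists_extension_right (b := -b) (R := R)
    (w := fun t => w (-t)) (by filter_upwards [hneg.eventually hw] with t ht using hrev ht)
    (by
      have h : Tendsto (fun t : ℝ => -t) (𝓝[>] b) (𝓝[<] (-b)) := tendsto_neg_nhdsGT
      exact h.frequently (by simpa using hR))
  refine ⟨δ, hδ, fun t => v (-t), fun t ht => ?_, fun t ht => ?_⟩
  · simpa using hvw (-t) (by simpa using ht)
  · have h := hv (-t) ⟨by linarith [ht.2], by linarith [ht.1]⟩
    simpa using hrev (g := v) h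

end ODE

/-- A positive solution of `y' ≥ κ y ^ p` with `p ≥ 2` cannot exist for all positive times. -/
theorem not_global_of_deriv_ge_pow {y y' : ℝ → ℝ} {κ : ℝ} {p : ℕ} (hp : 2 ≤ p) (hκ : 0 < κ)
    (h0 : 0 < y 0) (hy : ∀ t, 0 ≤ t → HasDerivAt y (y' t) t)
    (hy' : ∀ t, 0 ≤ t → κ * |y t| ^ p ≤ y' t) : False := by
  have hcont : ContinuousOn y (Set.Ici 0) := HasDerivAt.continuousOn fun t ht => hy t ht
  have hmono : MonotoneOn y (Set.Ici 0) := by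
    refine monotoneOn_of_deriv_nonneg (convex_Ici 0) hcont
      (fun t ht => (hy t (interior_subset ht)).differentiableAt.differentiableWithinAt)
      fun t ht => ?_
    rw [(hy t (interior_subset ht)).deriv]
    exact le_trans (by positivity) (hy' t (interior_subset ht))
  have hge (t : ℝ) (ht : 0 ≤ t) : y 0 ≤ y t := hmono (Set.mem_Ici.2 le_rfl) ht ht
  have hpos (t : ℝ) (ht : 0 ≤ t) : 0 < y t := h0.trans_le (hge t ht)
  -- Monotonicity of `y` reduces the power `p` to the quadratic case `y' ≥ c y²`, where `1 / y + c
  -- t` is nonincreasing.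
  set c : ℝ := κ * y 0 ^ (p - 2) with hc
  have hc0 : 0 < c := by positivity
  have hder (t : ℝ) (ht : 0 ≤ t) :
      HasDerivAt (fun t => (y t)⁻¹ + c * t) (-y' t / y t ^ 2 + c * 1) t :=
    ((hy t ht).inv (hpos t ht).ne').add ((hasDerivAt_id t).const_mul c)
  have hanti : AntitoneOn (fun t => (y t)⁻¹ + c * t) (Set.Ici 0) := by
    refine antitoneOn_of_deriv_nonpos (convex_Ici 0)
      (HasDerivAt.continuousOn fun t ht => hder t ht)
      (fun t ht => (hder t (interior_subset ht)).differentiableAt.differentiableWithinAt)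
      fun t ht => ?_
    have ht' : 0 ≤ t := interior_subset ht
    rw [(hder t ht').deriv]
    have h1 : c ≤ y' t / y t ^ 2 := by
      rw [le_div_iff₀ (pow_pos (hpos t ht') 2)]
      refine le_trans ?_ (hy' t ht')
      rw [abs_of_pos (hpos t ht'), hc, mul_assoc]
      calc κ * (y 0 ^ (p - 2) * y t ^ 2) ≤ κ * (y t ^ (p - 2) * y t ^ 2) := by
            have := hge t ht'
            gcongr
        _ = κ * y t ^ p := by rw [← pow_add, Nat.sub_add_cancel hp]
    rw [neg_div]
    linarith
  -- At the time `1 / (c y(0))` the monotone quantity forces `1 / y ≤ 0`.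
  have hT : 0 ≤ (y 0)⁻¹ / c := by positivity
  have h := hanti (Set.mem_Ici.2 le_rfl) hT hT
  have h2 := inv_pos.2 (hpos _ hT)
  simp only [mul_zero, add_zero] at h
  rw [mul_div_cancel₀ _ hc0.ne'] at h
  linarith

open L1

/-! ### The mean value of a power -/

/-- Bernoulli's inequality in homogeneous form. -/
theorem pow_tangent_le {x m : ℝ} (hx : 0 ≤ x) (hm : 0 ≤ m) (n : ℕ) :
    (n + 1) * m ^ n * x - n * m ^ (n + 1) ≤ x ^ (n + 1) := by
  induction n with
  | zero => simp
  | succ n ih =>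
    have h1 := mul_le_mul_of_nonneg_right ih hx
    have h2 : 0 ≤ (n + 1) * m ^ n * (x - m) ^ 2 := by positivity
    push_cast
    calc _ = ((n + 1) * m ^ n * x - n * m ^ (n + 1)) * x - (n + 1) * m ^ n * (x - m) ^ 2 := by ring
      _ ≤ x ^ (n + 1) * x := by linarith
      _ = _ := by ring

section Jensen

variable {Γ : AddSubgroup ℝ}

theorem absPow_zero_im (k : ℕ) (w : L1 Γ) : (absPow k w 0).im = 0 :=
  (hasMean_eval (absPow k w)).im_eq_zero (isAlmostPeriodic_eval _).continuous fun x => by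
    rw [eval_absPow, Complex.ofReal_im]

/-- Jensen's inequality for the mean value: average the tangent line bound of `x ^ (2k)` at `m =
|M(u)|`, with `|u|` replaced by the smaller `Re (θ u)`, where the rotation `θ` makes the mean of `θ
u` equal to `m`. -/
theorem norm_pow_le_absPow_zero {k : ℕ} (hk : 0 < k) (w : L1 Γ) :
    ‖w 0‖ ^ (2 * k) ≤ (absPow k w 0).re := by
  obtain ⟨n, hn⟩ : ∃ n, 2 * k = n + 1 := ⟨2 * k - 1, by omega⟩
  set m := ‖w 0‖ with hm
  obtain ⟨θ, hθ, hθw⟩ : ∃ θ : ℂ, ‖θ‖ = 1 ∧ θ * w 0 = m := by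
    by_cases h : w 0 = 0
    · exact ⟨1, by simp, by simp [hm, h]⟩
    · have h' : (m : ℂ) ≠ 0 := by simpa [hm] using h
      refine ⟨m / w 0, ?_, by field_simp⟩
      rw [norm_div, Complex.norm_real, hm, norm_norm, div_self (norm_ne_zero_iff.2 h)]
  have hc (v : L1 Γ) : Continuous fun x => eval x v := (isAlmostPeriodic_eval v).continuous
  set A : ℂ := (((n + 1) * m ^ n : ℝ) : ℂ) with hA
  have h := ((hasMean_eval (absPow k w)).sub (hc _) ((hc w).const_mul (A * θ))
    ((hasMean_eval w).const_mul (A * θ))).le_re (c := -(n * m ^ (n + 1)))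
    ((hc _).sub ((hc w).const_mul _)) fun x => by
      have h1 := pow_tangent_le (norm_nonneg (eval x w)) (norm_nonneg (w 0)) n
      have h2 : (θ * eval x w).re ≤ ‖eval x w‖ := by
        simpa [hθ] using Complex.re_le_norm (θ * eval x w)
      have h3 : (n + 1) * m ^ n * (θ * eval x w).re ≤ (n + 1) * m ^ n * ‖eval x w‖ := by gcongr
      change _ ≤ (eval x (absPow k w) - A * θ * eval x w).re
      rw [Complex.sub_re, eval_absPow, Complex.ofReal_re, hn, mul_assoc, hA, Complex.re_ofReal_mul]
      linarith
  rw [Complex.sub_re, mul_assoc, hθw, hA, Complex.re_ofReal_mul, Complex.ofReal_re] at h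
  rw [hn]
  have e : (n + 1) * m ^ n * m = n * m ^ (n + 1) + m ^ (n + 1) := by ring
  linarith

end Jensen

/-! ### The equation in the interaction picture -/

theorem isOpen_timeInterval (Tm Tp : EReal) : IsOpen (timeInterval Tm Tp) :=
  (isOpen_Ioo (a := -Tm) (b := Tp)).preimage continuous_coe_real_ereal

theorem zero_mem_timeInterval {Tm Tp : EReal} (hm : 0 < Tm) (hp : 0 < Tp) :
    (0 : ℝ) ∈ timeInterval Tm Tp := ⟨by simpa using hm, hp⟩

theorem uIcc_subset_timeInterval {Tm Tp : EReal} {s t : ℝ} (hs : s ∈ timeInterval Tm Tp)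
    (ht : t ∈ timeInterval Tm Tp) : Set.uIcc s t ⊆ timeInterval Tm Tp := by
  refine Set.OrdConnected.uIcc_subset ⟨fun a ha b hb c hc => ?_⟩ hs ht
  exact ⟨ha.1.trans_le (EReal.coe_le_coe_iff.2 hc.1), (EReal.coe_le_coe_iff.2 hc.2).trans_lt hb.2⟩

/-- `w` solves the equation in the interaction picture on `I`. -/
def IsInteractionSolution {Γ : AddSubgroup ℝ} (k : ℕ) (lam : ℂ) (I : Set ℝ) (w : ℝ → L1 Γ) : Prop :=
  ∀ t ∈ I, HasDerivAt w (field k lam t (w t)) t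

theorem isTameField_field {Γ : AddSubgroup ℝ} (k : ℕ) (lam : ℂ) :
    IsTameField (field (Γ := Γ) k lam) where
  continuous_time _ := continuousOn_univ.1 <|
    continuousOn_field k lam continuousOn_id continuousOn_const
  lip := exists_lipschitz_field k lam
  bound := exists_norm_field_le k lam

section Solutions

variable {ω : ℕ → ℝ} {k : ℕ} {lam : ℂ} {Tm Tp : EReal}

theorem propagator_norm_pow (t : ℝ) (w : L1 (freqGroup ω)) (x : ℝ) :
    propagator ω t (fun y => ((‖eval y w‖ ^ (2 * k) : ℝ) : ℂ)) x = eval x (prop t (absPow k w)) := by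
  rw [← propagator_eval]
  simp only [eval_absPow]

theorem eval_prop_integral {H : ℝ → L1 (freqGroup ω)} {t : ℝ}
    (hH : IntervalIntegrable H MeasureTheory.volume 0 t) (x : ℝ) :
    eval x (prop t (∫ s in (0 : ℝ)..t, H s)) = ∫ s in (0 : ℝ)..t, eval x (prop t (H s)) :=
  ((((eval x).comp (prop t)).restrictScalars ℝ).intervalIntegral_comp_comm hH).symm

theorem eval_prop_field (t s x : ℝ) (w : L1 (freqGroup ω)) :
    eval x (prop t (field k lam s w)) = -(Complex.I * lam) *
      propagator ω (t - s) (fun y => ((‖eval y (prop s w)‖ ^ (2 * k) : ℝ) : ℂ)) x := by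
  rw [propagator_norm_pow, field, map_smul, map_smul, prop_prop, smul_eq_mul, ← sub_eq_add_neg]

theorem IsInteractionSolution.isSolution {w : ℝ → L1 (freqGroup ω)} (hm : 0 < Tm) (hp : 0 < Tp)
    (hw : IsInteractionSolution k lam (timeInterval Tm Tp) w) :
    IsSolution ω (2 * k) lam (fun x => eval x (w 0)) Tm Tp fun t x => eval x (prop t (w t)) where
  mem t _ := memA_eval _
  cont t ht := by
    have hwc : ContinuousOn w (timeInterval Tm Tp) := HasDerivAt.continuousOn hw
    have hc : ContinuousWithinAt (fun s => prop s (w s)) (timeInterval Tm Tp) t :=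
      continuousOn_prop continuousOn_id hwc t ht
    simp only [← map_sub, normA_eval]
    have h := (hc.tendsto.sub_const (prop t (w t))).enorm
    rw [sub_self, enorm_zero] at h
    exact h
  initial := by simp
  duhamel t ht x := by
    have hsub := uIcc_subset_timeInterval (zero_mem_timeInterval hm hp) ht
    have hcont : ContinuousOn (fun s => field k lam s (w s)) (Set.uIcc 0 t) :=
      continuousOn_field k lam continuousOn_id (HasDerivAt.continuousOn fun s hs => hw s (hsub hs))
    have hint := intervalIntegral.integral_eq_sub_of_hasDerivAt (fun s hs => hw s (hsub hs))
      hcont.intervalIntegrable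
    have e : w t = w 0 + ∫ s in (0 : ℝ)..t, field k lam s (w s) := by rw [hint]; abel
    rw [propagator_eval]
    conv_lhs => rw [e]
    rw [map_add, map_add, eval_prop_integral hcont.intervalIntegrable]
    simp only [eval_prop_field]
    rw [intervalIntegral.integral_const_mul]
    ring

theorem IsSolution.exists_interactionSolution {w₀ : L1 (freqGroup ω)} {u : ℝ → ℝ → ℂ} (hm : 0 < Tm)
    (hp : 0 < Tp) (hu : IsSolution ω (2 * k) lam (fun x => eval x w₀) Tm Tp u) :
    ∃ w : ℝ → L1 (freqGroup ω), w 0 = w₀ ∧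
      (∀ t ∈ timeInterval Tm Tp, u t = fun x => eval x (prop t (w t))) ∧
      IsInteractionSolution k lam (timeInterval Tm Tp) w := by
  have h0 := zero_mem_timeInterval hm hp
  have hopen := isOpen_timeInterval Tm Tp
  choose! W hW using fun t (ht : t ∈ timeInterval Tm Tp) => (hu.mem t ht).exists_eval
  have hWc : ContinuousOn W (timeInterval Tm Tp) := fun t ht => by
    refine tendsto_iff_edist_tendsto_0.2 ((hu.cont t ht).congr' ?_)
    filter_upwards [self_mem_nhdsWithin] with s hs
    rw [edist_eq_enorm_sub, ← normA_eval]
    simp only [map_sub, ← congrFun (hW s hs), ← congrFun (hW t ht)]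
  set H : ℝ → L1 (freqGroup ω) := fun s => field k lam s (prop (-s) (W s)) with hH
  have hgc : ContinuousOn (fun s => prop (-s) (W s)) (timeInterval Tm Tp) :=
    continuousOn_prop continuousOn_id.neg hWc
  have hHc : ContinuousOn H (timeInterval Tm Tp) :=
    continuousOn_field k lam continuousOn_id hgc
  have hHint (t : ℝ) (ht : t ∈ timeInterval Tm Tp) :
      IntervalIntegrable H MeasureTheory.volume 0 t :=
    (hHc.mono (uIcc_subset_timeInterval h0 ht)).intervalIntegrable
  -- Defining `w` by the integral makes it differentiable at once; the pointwise Duhamel formula and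
  -- injectivity of evaluation then identify `prop t (w t)` with the coefficients of `u t`.
  set w : ℝ → L1 (freqGroup ω) := fun t => w₀ + ∫ s in (0 : ℝ)..t, H s with hw
  have hWw (t : ℝ) (ht : t ∈ timeInterval Tm Tp) : W t = prop t (w t) := by
    refine eval_injective fun x => ?_
    rw [← congrFun (hW t ht), hu.duhamel t ht, propagator_eval, hw, map_add, map_add,
      eval_prop_integral (hHint t ht), sub_eq_add_neg, ← neg_mul,
      ← intervalIntegral.integral_const_mul]
    congr 1
    refine intervalIntegral.integral_congr fun s hs => ?_
    have hs' := uIcc_subset_timeInterval h0 ht hs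
    simp only [hH, eval_prop_field, prop_prop, add_neg_cancel, prop_zero, ← congrFun (hW s hs')]
  refine ⟨w, by simp [hw], fun t ht => by rw [hW t ht, hWw t ht], fun t ht => ?_⟩
  have hd := (intervalIntegral.integral_hasDerivAt_right (hHint t ht)
    (hHc.stronglyMeasurableAtFilter hopen t ht) (hHc.continuousAt (hopen.mem_nhds ht))).const_add w₀
  convert hd using 1
  change _ = field k lam t (prop (-t) (W t))
  rw [hWw t ht, prop_prop, neg_add_cancel, prop_zero]

end Solutions

/-! ### Blow-up -/

theorem not_global_of_hasDerivAt_mul {y q : ℝ → ℝ} {m : ℝ} {p : ℕ} (hp : 2 ≤ p)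
    (hy : ∀ t, 0 ≤ t → HasDerivAt y (m * q t) t) (hq : ∀ t, 0 ≤ t → |y t| ^ p ≤ q t)
    (h0 : 0 < m * y 0) : False := by
  have hm : 0 < |m| := abs_pos.2 fun h => by simp [h] at h0
  -- Multiplying by `m` makes the initial value positive and the derivative `m² q`; `κ` absorbs the
  -- rescaling of `|y| ^ p`.
  refine not_global_of_deriv_ge_pow (y := fun t => m * y t) (κ := m ^ 2 / |m| ^ p) hp ?_ h0
    (fun t ht => (hy t ht).const_mul m) fun t ht => ?_
  · rw [← sq_abs]
    positivity
  · rw [abs_mul, mul_pow]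
    calc m ^ 2 / |m| ^ p * (|m| ^ p * |y t| ^ p) = m ^ 2 * |y t| ^ p := by field_simp
      _ ≤ m ^ 2 * q t := by
        have := hq t ht
        gcongr
      _ = m * (m * q t) := by ring

theorem not_global_of_hasDerivAt_mul_complex {c : ℝ → ℂ} {q : ℝ → ℝ} {μ : ℂ} {p : ℕ} (hp : 2 ≤ p)
    (hc : ∀ t, 0 ≤ t → HasDerivAt c (μ * q t) t) (hq : ∀ t, 0 ≤ t → ‖c t‖ ^ p ≤ q t)
    (h0 : 0 < μ.re * (c 0).re ∨ 0 < μ.im * (c 0).im) : False := by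
  rcases h0 with h0 | h0
  · refine not_global_of_hasDerivAt_mul (y := fun t => (c t).re) (q := q) hp (fun t ht => ?_)
      (fun t ht => ?_) h0
    · simpa [Function.comp_def] using Complex.reCLM.hasFDerivAt.comp_hasDerivAt t (hc t ht)
    · exact (pow_le_pow_left₀ (abs_nonneg _) (Complex.abs_re_le_norm _) p).trans (hq t ht)
  · refine not_global_of_hasDerivAt_mul (y := fun t => (c t).im) (q := q) hp (fun t ht => ?_)
      (fun t ht => ?_) h0
    · simpa [Function.comp_def] using Complex.imCLM.hasFDerivAt.comp_hasDerivAt t (hc t ht)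
    · exact (pow_le_pow_left₀ (abs_nonneg _) (Complex.abs_im_le_norm _) p).trans (hq t ht)

/-- The symbol equals `1` at frequency `0`, so the outer propagator disappears from this coordinate.
-/
theorem IsInteractionSolution.hasDerivAt_zero {Γ : AddSubgroup ℝ} {k : ℕ} {lam : ℂ} {I : Set ℝ}
    {w : ℝ → L1 Γ} (hw : IsInteractionSolution k lam I w) {t : ℝ} (ht : t ∈ I) :
    HasDerivAt (fun s => w s 0)
      (-(Complex.I * lam) * ((absPow k (prop t (w t)) 0).re : ℂ)) t := by
  have h := ((coord (0 : Γ)).restrictScalars ℝ).hasFDerivAt.comp_hasDerivAt t (hw t ht)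
  have e : ((absPow k (prop t (w t)) 0).re : ℂ) = absPow k (prop t (w t)) 0 :=
    Complex.ext (by simp) (by simp [absPow_zero_im])
  have e' : field k lam t (w t) 0 = -(Complex.I * lam) * absPow k (prop t (w t)) 0 := by
    rw [field, smul_apply, prop_apply]
    simp [symbol]
  rw [e, ← e']
  exact h

theorem norm_zero_pow_le {Γ : AddSubgroup ℝ} {k : ℕ} (hk : 0 < k) (t : ℝ) (w : L1 Γ) :
    ‖w 0‖ ^ (2 * k) ≤ (absPow k (prop t w) 0).re := by
  have h := norm_pow_le_absPow_zero hk (prop t w)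
  rwa [prop_apply, norm_mul, norm_symbol, one_mul] at h

/-! ### Finite lifespan and divergence of the norm for maximal solutions -/

section Maximal

variable {ω : ℕ → ℝ} {k : ℕ} {lam : ℂ} {Tm Tp : EReal} {w : ℝ → L1 (freqGroup ω)}
  {u : ℝ → ℝ → ℂ}

theorem IsInteractionSolution.lt_top_right (hk : 0 < k)
    (hw : IsInteractionSolution k lam (timeInterval Tm Tp) w) (hm : 0 < Tm)
    (h0 : lam.re * (w 0 0).im < 0 ∨ lam.im * (w 0 0).re > 0) : Tp < ⊤ := by
  by_contra htop
  rw [not_lt_top_iff] at htop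
  have hmem (t : ℝ) (ht : 0 ≤ t) : t ∈ timeInterval Tm Tp :=
    ⟨(EReal.neg_lt_zero.2 hm).trans_le (EReal.coe_nonneg.2 ht), htop ▸ EReal.coe_lt_top t⟩
  refine not_global_of_hasDerivAt_mul_complex (p := 2 * k) (by omega)
    (fun t ht => hw.hasDerivAt_zero (hmem t ht)) (fun t _ => norm_zero_pow_le hk t (w t)) ?_
  -- Here `μ = -iλ`, so `Re μ = Im λ` and `Im μ = -Re λ`.
  simp only [Complex.neg_re, Complex.neg_im, Complex.I_mul_re, Complex.I_mul_im]
  rcases h0 with h | h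
  · exact Or.inr (by linarith)
  · exact Or.inl (by linarith)

theorem IsInteractionSolution.lt_top_left (hk : 0 < k)
    (hw : IsInteractionSolution k lam (timeInterval Tm Tp) w) (hp : 0 < Tp)
    (h0 : lam.re * (w 0 0).im > 0 ∨ lam.im * (w 0 0).re < 0) : Tm < ⊤ := by
  by_contra htop
  rw [not_lt_top_iff] at htop
  have hmem (t : ℝ) (ht : 0 ≤ t) : -t ∈ timeInterval Tm Tp :=
    ⟨by rw [htop, EReal.neg_top]; exact EReal.bot_lt_coe _,
      (EReal.coe_le_coe_iff.2 (neg_nonpos.2 ht)).trans_lt hp⟩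
  refine not_global_of_hasDerivAt_mul_complex (p := 2 * k) (c := fun t => w (-t) 0)
    (μ := Complex.I * lam) (by omega)
    (fun t ht => ?_) (fun t _ => norm_zero_pow_le hk (-t) (w (-t))) ?_
  · have h := (hw.hasDerivAt_zero (hmem t ht)).scomp t (hasDerivAt_neg t)
    simpa [Function.comp_def] using h
  · simp only [Complex.I_mul_re, Complex.I_mul_im, neg_zero]
    rcases h0 with h | h
    · exact Or.inr h
    · exact Or.inl (by linarith)

/-- The propagator is isometric, so a finite liminf for `u` returns `w` to one fixed ball at times
arbitrarily far along the filter. -/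
theorem frequently_norm_le_of_liminf_ne_top {l : Filter ℝ} {I : Set ℝ} (hI : ∀ᶠ t in l, t ∈ I)
    (hu : ∀ t ∈ I, u t = fun x => eval x (prop t (w t)))
    (h : liminf (fun t => normA ω (u t)) l ≠ ⊤) : ∃ R : ℝ, ∃ᶠ t in l, ‖w t‖ ≤ R := by
  obtain ⟨R, hR, hRtop⟩ := exists_between (lt_top_iff_ne_top.2 h)
  refine ⟨R.toReal, ((frequently_lt_of_liminf_lt (by isBoundedDefault) hR).and_eventually hI).mono
    fun t ht => ?_⟩
  have h1 := ht.1
  rw [hu t ht.2, normA_eval, ← ofReal_norm, norm_prop] at h1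
  exact (ENNReal.ofReal_le_iff_le_toReal hRtop.ne).1 h1.le

theorem IsMaximalSolution.liminf_right {w₀ : L1 (freqGroup ω)} {T : ℝ}
    (hu : IsMaximalSolution ω (2 * k) lam (fun x => eval x w₀) Tm T u) :
    liminf (fun t : ℝ => normA ω (u t)) (𝓝[<] T) = ⊤ := by
  have hm := hu.pos_left
  have hp := hu.pos_right
  obtain ⟨w, hw0, huw, hw⟩ := hu.sol.exists_interactionSolution hm hp
  have hT : 0 < T := EReal.coe_pos.1 hp
  by_contra hlim
  have hnear : ∀ᶠ t in 𝓝[<] T, t ∈ timeInterval Tm T := by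
    filter_upwards [Ioo_mem_nhdsLT hT] with t ht
    exact ⟨(EReal.neg_lt_zero.2 hm).trans (EReal.coe_pos.2 ht.1), EReal.coe_lt_coe_iff.2 ht.2⟩
  obtain ⟨R, hR⟩ := frequently_norm_le_of_liminf_ne_top hnear huw hlim
  obtain ⟨δ, hδ, v, hvw, hv⟩ := (isTameField_field k lam).exists_extension_right
    (hnear.mono fun t ht => hw t ht) hR
  have hvsol : IsInteractionSolution k lam (timeInterval Tm ((T + δ : ℝ) : EReal)) v := by
    intro t ht
    by_cases htT : t < T
    · have h := hw t ⟨ht.1, EReal.coe_lt_coe_iff.2 htT⟩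
      rw [← hvw t htT] at h
      exact h.congr_of_eventuallyEq (by filter_upwards [Iio_mem_nhds htT] with s hs using hvw s hs)
    · exact hv t ⟨not_lt.1 htT, EReal.coe_lt_coe_iff.1 ht.2⟩
  have hlt : (T : EReal) < ((T + δ : ℝ) : EReal) := EReal.coe_lt_coe_iff.2 (by linarith)
  have hsol := hvsol.isSolution hm (hp.trans hlt)
  rw [hvw 0 hT, hw0] at hsol
  refine hlt.ne' (hu.maximal Tm _ _ le_rfl hlt.le hsol fun t ht => ?_).2
  rw [huw t ht, hvw t (EReal.coe_lt_coe_iff.1 ht.2)]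

theorem IsMaximalSolution.liminf_left {w₀ : L1 (freqGroup ω)} {T : ℝ}
    (hu : IsMaximalSolution ω (2 * k) lam (fun x => eval x w₀) T Tp u) :
    liminf (fun t : ℝ => normA ω (u t)) (𝓝[>] (-T)) = ⊤ := by
  have hm := hu.pos_left
  have hp := hu.pos_right
  obtain ⟨w, hw0, huw, hw⟩ := hu.sol.exists_interactionSolution hm hp
  have hT : 0 < T := EReal.coe_pos.1 hm
  have hT' : -T < 0 := neg_lt_zero.2 hT
  by_contra hlim
  have hnear : ∀ᶠ t in 𝓝[>] (-T), t ∈ timeInterval T Tp := by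
    filter_upwards [Ioo_mem_nhdsGT hT'] with t ht
    exact ⟨by exact_mod_cast ht.1, (EReal.coe_lt_coe_iff.2 ht.2).trans hp⟩
  obtain ⟨R, hR⟩ := frequently_norm_le_of_liminf_ne_top hnear huw hlim
  obtain ⟨δ, hδ, v, hvw, hv⟩ := (isTameField_field k lam).exists_extension_left
    (hnear.mono fun t ht => hw t ht) hR
  have hvsol : IsInteractionSolution k lam (timeInterval ((T + δ : ℝ) : EReal) Tp) v := by
    intro t ht
    by_cases htT : -T < t
    · have h := hw t ⟨by exact_mod_cast htT, ht.2⟩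
      rw [← hvw t htT] at h
      exact h.congr_of_eventuallyEq (by filter_upwards [Ioi_mem_nhds htT] with s hs using hvw s hs)
    · have h1 : -(T + δ) < t := by exact_mod_cast ht.1
      exact hv t ⟨by linarith, not_lt.1 htT⟩
  have hlt : (T : EReal) < ((T + δ : ℝ) : EReal) := EReal.coe_lt_coe_iff.2 (by linarith)
  have hsol := hvsol.isSolution (hm.trans hlt) hp
  rw [hvw 0 hT', hw0] at hsol
  refine hlt.ne' (hu.maximal _ Tp _ hlt.le le_rfl hsol fun t ht => ?_).1
  rw [huw t ht, hvw t (by exact_mod_cast ht.1)]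

theorem IsMaximalSolution.blowup_right {f : ℝ → ℂ} (hk : 0 < k) (hf : MemA ω f)
    (hu : IsMaximalSolution ω (2 * k) lam f Tm Tp u)
    (h0 : lam.re * (meanValue f).im < 0 ∨ lam.im * (meanValue f).re > 0) :
    Tp < ⊤ ∧ liminf (fun t : ℝ => normA ω (u t)) (𝓝[<] Tp.toReal) = ⊤ := by
  obtain ⟨w₀, rfl⟩ := hf.exists_eval
  obtain ⟨w, hw0, -, hw⟩ := hu.sol.exists_interactionSolution hu.pos_left hu.pos_right
  rw [meanValue_eval, ← hw0] at h0
  have hlt := hw.lt_top_right hk hu.pos_left h0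
  refine ⟨hlt, ?_⟩
  lift Tp to ℝ using ⟨hlt.ne, (EReal.bot_lt_zero.trans hu.pos_right).ne'⟩
  exact hu.liminf_right

theorem IsMaximalSolution.blowup_left {f : ℝ → ℂ} (hk : 0 < k) (hf : MemA ω f)
    (hu : IsMaximalSolution ω (2 * k) lam f Tm Tp u)
    (h0 : lam.re * (meanValue f).im > 0 ∨ lam.im * (meanValue f).re < 0) :
    Tm < ⊤ ∧ liminf (fun t : ℝ => normA ω (u t)) (𝓝[>] (-Tm.toReal)) = ⊤ := by
  obtain ⟨w₀, rfl⟩ := hf.exists_eval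
  obtain ⟨w, hw0, -, hw⟩ := hu.sol.exists_interactionSolution hu.pos_left hu.pos_right
  rw [meanValue_eval, ← hw0] at h0
  have hlt := hw.lt_top_left hk hu.pos_right h0
  refine ⟨hlt, ?_⟩
  lift Tm to ℝ using ⟨hlt.ne, (EReal.bot_lt_zero.trans hu.pos_left).ne'⟩
  exact hu.liminf_left

end Maximal

end APNLS

end

theorem theorem1p2 (p : ℕ) (hp : Even p) (hp0 : 0 < p) (ω : ℕ → ℝ) (lam : ℂ)
    (f : ℝ → ℂ) (hf : APNLS.MemA ω f) (Tm Tp : EReal) (u : ℝ → ℝ → ℂ)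
    (hu : APNLS.IsMaximalSolution ω p lam f Tm Tp u) :
    ((lam.re * (APNLS.meanValue f).im ≠ 0 ∨ lam.im * (APNLS.meanValue f).re ≠ 0) →
      min Tm Tp < ⊤) ∧
    ((lam.re * (APNLS.meanValue f).im < 0 ∨ lam.im * (APNLS.meanValue f).re > 0) →
      Tp < ⊤ ∧ liminf (fun t : ℝ => APNLS.normA ω (u t)) (𝓝[<] Tp.toReal) = ⊤) ∧
    ((lam.re * (APNLS.meanValue f).im > 0 ∨ lam.im * (APNLS.meanValue f).re < 0) →
      Tm < ⊤ ∧ liminf (fun t : ℝ => APNLS.normA ω (u t)) (𝓝[>] (-Tm.toReal)) = ⊤) := by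
  obtain ⟨k, rfl⟩ := even_iff_exists_two_mul.1 hp
  have hk : 0 < k := by omega
  refine ⟨fun h => ?_, hu.blowup_right hk hf, hu.blowup_left hk hf⟩
  rw [min_lt_iff]
  rcases h with h | h <;> rcases lt_or_gt_of_ne h with h | h
  · exact Or.inr (hu.blowup_right hk hf (Or.inl h)).1
  · exact Or.inl (hu.blowup_left hk hf (Or.inl h)).1
  · exact Or.inl (hu.blowup_left hk hf (Or.inr h)).1
  · exact Or.inr (hu.blowup_right hk hf (Or.inr h)).1
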